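/- Let $l\ge 3$, $N=2l-1$, $2\le n\le\infty$, and let $D\subseteq\mathbb R^2$ be open. Put $z=(x+\mathrm i y)/2$, so that $\partial_z=\partial_x-\mathrm i\partial_y$, $\partial_{\bar z}=\partial_x+\mathrm i\partial_y$ and $\triangle=\partial_x^2+\partial_y^2=\partial_z\partial_{\bar z}$. Let $u_1,\dots,u_l:D\to\mathbb R$ be $C^n$ functions that solve on $D$ the two dimensional elliptic $A_{2l-1}^{(2)}$ Toda system $$\triangle u_1=e^{u_2+u_1}-e^{u_2-u_1},\qquad \triangle u_2=e^{u_2+u_1}+e^{u_2-u_1}-e^{u_3-u_2},$$ $$\triangle u_j=e^{u_j-u_{j-1}}-e^{u_{j+1}-u_j}\ (3\le j\le l-1),\qquad \triangle u_l=e^{u_l-u_{l-1}}-e^{-2u_l}.$$ Divide $2l\times 2l$ matrices into $N\times N$ blocks, where block $1$ has size $2$ and blocks $2,\dots,N$ have size $1$. Let $J$ be the matrix whose blocks $J_{jk}$ with $k\equiv j+1 \pmod N$ have all entries $1$ and whose other blocks vanish, and let $V=\mathrm{diag}(e^{u_1},e^{-u_1},e^{u_2},\dots,e^{u_l},e^{-u_l},\dots,e^{-u_2})$.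 Let $\mu\in\mathbb C$, $\mu\neq0$, $|\mu|\ne1$, and let $H=(h_{11},h_{12},h_2,\dots,h_{2l-1})^T$ be a differentiable complex column solution on $D$ of the Lax pair $$H_z=(\mu J+V_zV^{-1})H,\qquad H_{\bar z}=\mu^{-1}VJ^TV^{-1}H .$$ For an integer $k$ let $\{k\}\in\{0,\dots,N-1\}$ be its remainder modulo $N$, and read subscripts of $h$ modulo $N$, so that $h_{2-c}=h_{2l+1-c}$ for $2\le c\le 2l-1$. For integers $j$ put $$\gamma_j=\frac1{1+|\mu|^{4l-2}}\Big((-|\mu|^2)^{\{j-1\}}\big(|h_{11}|^2e^{-u_1}+|h_{12}|^2e^{u_1}\big)+\sum_{c=2}^{l}(-|\mu|^2)^{\{j+c-2\}}|h_c|^2e^{-u_c}+\sum_{c=2}^{l}(-|\mu|^2)^{\{j-c\}}|h_{2-c}|^2e^{u_c}\Big),$$ $$g_j=\frac14\Big|2h_{11}h_{12}+\sum_{c=2}^{2l-1}(-1)^{\{c-j\}-\{1-j\}}h_{2-c}h_c\Big|^2-|\mu|^2\gamma_{j-1}\gamma_{2-j}.$$ Assume that on $D$ the quotients $$\frac{|h_{11}|^2e^{-u_1}-\gamma_1}{|h_{12}|^2e^{u_1}-\gamma_1}\quad\text{and}\quad\frac{g_{j+1}}{g_j}\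 (2\le j\le l)$$ are defined (nonzero denominators) and positive. Then $$\tilde u_1=u_1+\ln\frac{|h_{11}|^2e^{-u_1}-\gamma_1}{|h_{12}|^2e^{u_1}-\gamma_1},\qquad \tilde u_j=u_j+\ln\frac{g_{j+1}}{g_j}\quad(2\le j\le l)$$ are of class $C^n$ on $D$ and solve the same Toda system on $D$. -/

import Mathlib

namespace EllipticToda

/-- The real plane with coordinates `(x, y) = (p 0, p 1)`. -/
abbrev Plane : Type := EuclideanSpace ℝ (Fin 2)

/-- Partial derivative in `x` of a complex valued function. -/
noncomputable def dx (f : Plane → ℂ) (p : Plane) : ℂ :=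
  fderiv ℝ f p (EuclideanSpace.single 0 1)

/-- Partial derivative in `y` of a complex valued function. -/
noncomputable def dy (f : Plane → ℂ) (p : Plane) : ℂ :=
  fderiv ℝ f p (EuclideanSpace.single 1 1)

/-- `∂/∂z` for the coordinate `z = (x + i y) / 2`, i.e. `∂/∂x - i ∂/∂y`. -/
noncomputable def dz (f : Plane → ℂ) (p : Plane) : ℂ := dx f p - Complex.I * dy f p

/-- `∂/∂z̄` for the coordinate `z = (x + i y) / 2`, i.e. `∂/∂x + i ∂/∂y`. With this
normalization `∂/∂z ∂/∂z̄` is the Laplacian `∂²/∂x² + ∂²/∂y²`. -/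
noncomputable def dzbar (f : Plane → ℂ) (p : Plane) : ℂ := dx f p + Complex.I * dy f p

/-- The two dimensional elliptic Toda system of type `A_{2l-1}^{(2)}` (for `l ≥ 3`) on `D`, for
real functions `u 1, …, u l` of class `C^n`. The values of `u` at other indices play no role. -/
def IsTodaSolution (l : ℕ) (n : ℕ∞) (D : Set Plane) (u : ℕ → Plane → ℝ) : Prop :=
  (∀ j ∈ Finset.Icc 1 l, ContDiffOn ℝ n (u j) D) ∧
  ∀ p ∈ D,
    Laplacian.laplacian (u 1) p = Real.exp (u 2 p + u 1 p) - Real.exp (u 2 p - u 1 p) ∧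
    Laplacian.laplacian (u 2) p =
      Real.exp (u 2 p + u 1 p) + Real.exp (u 2 p - u 1 p) - Real.exp (u 3 p - u 2 p) ∧
    (∀ j ∈ Finset.Icc 3 (l - 1), Laplacian.laplacian (u j) p =
      Real.exp (u j p - u (j - 1) p) - Real.exp (u (j + 1) p - u j p)) ∧
    Laplacian.laplacian (u l) p = Real.exp (u l p - u (l - 1) p) - Real.exp (-2 * u l p)

/-! ### The Lax pair

There are `N = 2l - 1` blocks. The first has size `2` and occupies the rows `0` and `1` of a matrix
of size `2l`; the block number `k`, for `2 ≤ k ≤ 2l - 1`, has size `1` and occupies the row `k`. -/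

/-- The number (from `1` to `2l - 1`) of the block that contains a given row. -/
def block (a : ℕ) : ℕ := max a 1

/-- The matrix `J`: the blocks `J_{jk}` with `k ≡ j + 1` modulo `2l - 1` have all entries `1`, the
others vanish. -/
def J (l : ℕ) : Matrix (Fin (2 * l)) (Fin (2 * l)) ℂ :=
  Matrix.of fun a b => if block b ≡ block a + 1 [MOD 2 * l - 1] then 1 else 0

/-- The exponents in `V = diag(e^{u_1}, e^{-u_1}, e^{u_2}, …, e^{u_l}, e^{-u_l}, …, e^{-u_2})`. -/
def exponent (l : ℕ) (u : ℕ → Plane → ℝ) (p : Plane) (a : Fin (2 * l)) : ℝ :=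
  if (a : ℕ) = 0 then u 1 p
  else if (a : ℕ) = 1 then -u 1 p
  else if (a : ℕ) ≤ l then u a p
  else -u (2 * l + 1 - a) p

/-- The diagonal matrix `V`. -/
noncomputable def V (l : ℕ) (u : ℕ → Plane → ℝ) (p : Plane) :
    Matrix (Fin (2 * l)) (Fin (2 * l)) ℂ :=
  Matrix.diagonal fun a => ((Real.exp (exponent l u p a) : ℝ) : ℂ)

/-- `P = V_z V⁻¹`. -/
noncomputable def P (l : ℕ) (u : ℕ → Plane → ℝ) (p : Plane) :
    Matrix (Fin (2 * l)) (Fin (2 * l)) ℂ :=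
  (Matrix.of fun a b => dz (fun q => V l u q a b) p) * (V l u p)⁻¹

/-- `Q = V Jᵀ V⁻¹`. -/
noncomputable def Q (l : ℕ) (u : ℕ → Plane → ℝ) (p : Plane) :
    Matrix (Fin (2 * l)) (Fin (2 * l)) ℂ :=
  V l u p * (J l).transpose * (V l u p)⁻¹

/-- The column `(h₁₁, h₁₂, h₂, …, h_{2l-1})`. The values of `h` at indices other than
`2, …, 2l - 1` play no role. -/
def column (l : ℕ) (h₁₁ h₁₂ : Plane → ℂ) (h : ℕ → Plane → ℂ) (p : Plane) : Fin (2 * l) → ℂ :=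
  fun a => if (a : ℕ) = 0 then h₁₁ p else if (a : ℕ) = 1 then h₁₂ p else h a p

/-- `Φ` is a column solution on `D` of the Lax pair `Φ_z = (μ J + P) Φ`, `Φ_z̄ = μ⁻¹ Q Φ`. -/
def IsLaxSolution (l : ℕ) (D : Set Plane) (μ : ℂ) (u : ℕ → Plane → ℝ)
    (Φ : Plane → Fin (2 * l) → ℂ) : Prop :=
  (∀ a, DifferentiableOn ℝ (fun q => Φ q a) D) ∧
  ∀ p ∈ D,
    (fun a => dz (fun q => Φ q a) p) = (μ • J l + P l u p).mulVec (Φ p) ∧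
    (fun a => dzbar (fun q => Φ q a) p) = (μ⁻¹ • Q l u p).mulVec (Φ p)

/-! ### The Darboux transformation -/

/-- The remainder `{k}` of the integer `k` modulo `N = 2l - 1`. -/
def remN (l : ℕ) (k : ℤ) : ℕ := (k % (2 * (l : ℤ) - 1)).toNat

/-- The function `γ_j`. The subscript `2 - c` of `h` is taken modulo `2l - 1`, that is
`h_{2-c} = h_{2l+1-c}`. -/
noncomputable def gam (l : ℕ) (μ : ℂ) (u : ℕ → Plane → ℝ) (h₁₁ h₁₂ : Plane → ℂ)
    (h : ℕ → Plane → ℂ) (j : ℤ) (p : Plane) : ℝ :=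
  1 / (1 + ‖μ‖ ^ (4 * l - 2)) *
    ((-‖μ‖ ^ 2) ^ remN l (j - 1) *
        (‖h₁₁ p‖ ^ 2 * Real.exp (-u 1 p) + ‖h₁₂ p‖ ^ 2 * Real.exp (u 1 p))
      + ∑ c ∈ Finset.Icc 2 l,
          (-‖μ‖ ^ 2) ^ remN l (j + c - 2) * ‖h c p‖ ^ 2 * Real.exp (-u c p)
      + ∑ c ∈ Finset.Icc 2 l,
          (-‖μ‖ ^ 2) ^ remN l (j - c) * ‖h (2 * l + 1 - c) p‖ ^ 2 * Real.exp (u c p))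

/-- The function `g_j`. Again `h_{2-c} = h_{2l+1-c}`. -/
noncomputable def g (l : ℕ) (μ : ℂ) (u : ℕ → Plane → ℝ) (h₁₁ h₁₂ : Plane → ℂ)
    (h : ℕ → Plane → ℂ) (j : ℤ) (p : Plane) : ℝ :=
  1 / 4 * ‖2 * h₁₁ p * h₁₂ p + ∑ c ∈ Finset.Icc 2 (2 * l - 1),
      (-1 : ℂ) ^ ((remN l (c - j) : ℤ) - (remN l (1 - j) : ℤ)) *
        h (2 * l + 1 - c) p * h c p‖ ^ 2
    - ‖μ‖ ^ 2 * gam l μ u h₁₁ h₁₂ h (j - 1) p * gam l μ u h₁₁ h₁₂ h (2 - j) p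

/-- The factor by which `e^{u_j}` is multiplied. -/
noncomputable def factor (l : ℕ) (μ : ℂ) (u : ℕ → Plane → ℝ) (h₁₁ h₁₂ : Plane → ℂ)
    (h : ℕ → Plane → ℂ) (j : ℕ) (p : Plane) : ℝ :=
  if j = 1 then
    (‖h₁₁ p‖ ^ 2 * Real.exp (-u 1 p) - gam l μ u h₁₁ h₁₂ h 1 p) /
      (‖h₁₂ p‖ ^ 2 * Real.exp (u 1 p) - gam l μ u h₁₁ h₁₂ h 1 p)
  else g l μ u h₁₁ h₁₂ h (j + 1) p / g l μ u h₁₁ h₁₂ h j p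

/-- The transformed functions `ũ_j = u_j + ln (factor j)`. -/
noncomputable def darboux (l : ℕ) (μ : ℂ) (u : ℕ → Plane → ℝ) (h₁₁ h₁₂ : Plane → ℂ)
    (h : ℕ → Plane → ℂ) (j : ℕ) (p : Plane) : ℝ :=
  u j p + Real.log (factor l μ u h₁₁ h₁₂ h j p)

end EllipticToda

namespace EllipticToda

open Complex Topology
open scoped ComplexConjugate

/-! The proof is a tau-function computation: each factor is a quotient of functions whose logarithms
have explicit Laplacians, and these Laplacians exchange the old exponentials for the new ones.

Passing from `H` to `κ = V⁻¹H` absorbs `V_z V⁻¹`, and the Lax pair becomes `∂_z̄ h_c = μ⁻¹ e^{v_c}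
κ_{c-1}`, `∂_z κ_c = μ e^{-v_c} h_{c+1}` (`reducedLax`), with no derivative of `u`; block `1`
contributes the sum of its two entries to its neighbours. Consequently `γ_j`, a cyclic sum of the
weights `h_c conj κ_c` with ratio `-|μ|²`, has a `z̄`-derivative that telescopes to a single product
(`ReducedLax.gam_zbar`). The symmetry `v_{2-c} = -v_c` gives `h_{2-c} h_c = κ_{2-c} κ_c`, so the
alternating sum `G_j` of these products telescopes under both derivatives (`ReducedLax.gsum_z`,
`ReducedLax.gsum_zbar`). Moreover `γ_{j+1} + |μ|² γ_j` and `G_j + G_{j+1}` are single terms.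

With `g_j = |G_j|² - |μ|² γ_{j-1} γ_{2-j}`, everything is therefore polynomial in finitely many
local quantities, and an algebraic identity yields `△ ln |g_j| = e^{v_j - v_{j-1}} (1 - g_{j+1}
g_{j-1} / g_j²)` for `3 ≤ j ≤ l + 1` (`laplacian_log_g`). At one end `g_2 = X Y` (`g_two`), where `X
/ Y` is the factor of `e^{u_1}`, and `X`, `Y` satisfy similar identities involving `g_3`
(`laplacian_log_boundary`). At the other end `g_{l+2} = g_l` (`g_reflect`) closes the chain.

The Toda equations for `u` enter only at the end: in `△ũ_j` the old exponentials cancel, and the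
remaining terms are the exponentials of the `ũ_k`. -/

/-- `f` is differentiable at `p` and `∂f/∂x + ε ∂f/∂y = a` there. The values `ε = ∓i` give the
derivatives in `z` and in `z̄`. -/
def HasD (ε : ℂ) (f : Plane → ℂ) (a : ℂ) (p : Plane) : Prop :=
  DifferentiableAt ℝ f p ∧ dx f p + ε * dy f p = a

/-! ### Calculus of the first order operators `∂_z` and `∂_z̄` -/

namespace HasD

variable {ε a b : ℂ} {f g : Plane → ℂ} {p : Plane}

theorem congr_deriv (h : HasD ε f a p) (hab : a = b) : HasD ε f b p := hab ▸ h

theorem congr_of_eventuallyEq (h : HasD ε f a p) (hg : g =ᶠ[𝓝 p] f) : HasD ε g a p :=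
  ⟨h.1.congr_of_eventuallyEq hg, by
    rw [← h.2, dx, dy, dx, dy, hg.fderiv_eq]⟩

theorem const (c : ℂ) : HasD ε (fun _ => c) 0 p :=
  ⟨differentiableAt_const c, by simp [dx, dy]⟩

theorem add (hf : HasD ε f a p) (hg : HasD ε g b p) :
    HasD ε (fun q => f q + g q) (a + b) p :=
  ⟨hf.1.add hg.1, by
    rw [← hf.2, ← hg.2, dx, dy, fderiv_fun_add hf.1 hg.1]
    simp only [dx, dy, add_apply]
    ring⟩

theorem mul (hf : HasD ε f a p) (hg : HasD ε g b p) :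
    HasD ε (fun q => f q * g q) (a * g p + f p * b) p :=
  ⟨hf.1.mul hg.1, by
    rw [← hf.2, ← hg.2, dx, dy, fderiv_fun_mul hf.1 hg.1]
    simp only [dx, dy, add_apply, smul_apply, smul_eq_mul]
    ring⟩

theorem const_mul (c : ℂ) (hf : HasD ε f a p) : HasD ε (fun q => c * f q) (c * a) p :=
  ((const c).mul hf).congr_deriv (by ring)

theorem neg (hf : HasD ε f a p) : HasD ε (fun q => -f q) (-a) p := by
  simpa using hf.const_mul (-1)

theorem sub (hf : HasD ε f a p) (hg : HasD ε g b p) :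
    HasD ε (fun q => f q - g q) (a - b) p := by
  simpa [sub_eq_add_neg] using hf.add hg.neg

theorem sum {ι : Type*} {s : Finset ι} {F : ι → Plane → ℂ} {A : ι → ℂ}
    (h : ∀ i ∈ s, HasD ε (F i) (A i) p) :
    HasD ε (fun q => ∑ i ∈ s, F i q) (∑ i ∈ s, A i) p := by
  classical
  induction s using Finset.induction_on with
  | empty => simpa using const 0
  | insert i s hi ih =>
    simp only [Finset.sum_insert hi]
    exact (h i (Finset.mem_insert_self i s)).add
      (ih fun j hj => h j (Finset.mem_insert_of_mem hj))

theorem conjugate (hf : HasD ε f a p) : HasD (conj ε) (fun q => conj (f q)) (conj a) p := by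
  have h := (Complex.conjCLE.toContinuousLinearMap.hasFDerivAt (x := f p)).comp p hf.1.hasFDerivAt
  refine ⟨h.differentiableAt, ?_⟩
  have h' : fderiv ℝ (fun q => conj (f q)) p = _ := h.fderiv
  rw [← hf.2, dx, dy, h']
  simp [dx, dy]

theorem conj_dz (hf : HasD (-I) f a p) : HasD I (fun q => conj (f q)) (conj a) p := by
  simpa using hf.conjugate

theorem conj_dzbar (hf : HasD I f a p) :
    HasD (-I) (fun q => conj (f q)) (conj a) p := by
  simpa using hf.conjugate

theorem differentiableAt_re {φ : Plane → ℝ} (h : HasD ε (fun q => (φ q : ℂ)) a p) :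
    DifferentiableAt ℝ φ p := by
  simpa [Function.comp_def] using (Complex.reCLM.differentiableAt (x := (φ p : ℂ))).comp p h.1

theorem ofReal_comp {φ : Plane → ℝ} {ψ : ℝ → ℝ} {ψ' : ℝ} (hψ : HasDerivAt ψ ψ' (φ p))
    (h : HasD ε (fun q => (φ q : ℂ)) a p) : HasD ε (fun q => (ψ (φ q) : ℂ)) (ψ' * a) p := by
  have hφ := h.differentiableAt_re.hasFDerivAt
  have h1 := (Complex.ofRealCLM.hasFDerivAt (x := φ p)).comp p hφ
  have h2 := (Complex.ofRealCLM.hasFDerivAt (x := ψ (φ p))).comp p (hψ.comp_hasFDerivAt p hφ)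
  refine ⟨h2.differentiableAt, ?_⟩
  have e1 : fderiv ℝ (fun q => (φ q : ℂ)) p = _ := h1.fderiv
  have e2 : fderiv ℝ (fun q => (ψ (φ q) : ℂ)) p = _ := h2.fderiv
  rw [← h.2, dx, dy, dx, dy, e1, e2]
  simp
  ring

end HasD

/-! ### Laplacians from iterated first order derivatives -/

/-- This is `△ = ∂_z̄ ∂_z`. Comparing real parts suffices, since the mixed derivatives of a real
function only enter the imaginary part; their symmetry is not needed. -/
theorem laplacian_eq_of_hasD {f : Plane → ℝ} {F : Plane → ℂ} {p : Plane} {r : ℝ}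
    (hf : ContDiffAt ℝ 2 f p)
    (hF : ∀ᶠ q in 𝓝 p, HasD (-I) (fun q => (f q : ℂ)) (F q) q) (hb : HasD I F r p) :
    Laplacian.laplacian f p = r := by
  have hd : DifferentiableAt ℝ (fderiv ℝ f) p :=
    (hf.fderiv_right (m := 1) (by norm_num)).differentiableAt one_ne_zero
  have hv : ∀ v : Plane, HasFDerivAt (fun q => ((fderiv ℝ f q v : ℝ) : ℂ))
      (Complex.ofRealCLM.comp ((fderiv ℝ (fderiv ℝ f) p).flip v)) p := fun v =>
    Complex.ofRealCLM.hasFDerivAt.comp p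
      ((hd.hasFDerivAt.clm_apply (hasFDerivAt_const v p)).congr_fderiv (by ext w; simp))
  have hF' : F =ᶠ[𝓝 p] fun q => ((fderiv ℝ f q (EuclideanSpace.single 0 1) : ℝ) : ℂ)
      + -I * ((fderiv ℝ f q (EuclideanSpace.single 1 1) : ℝ) : ℂ) := by
    filter_upwards [hF] with q hq
    have h1 := (Complex.ofRealCLM.hasFDerivAt (x := f q)).comp q
      hq.differentiableAt_re.hasFDerivAt
    have e1 : fderiv ℝ (fun q => (f q : ℂ)) q = _ := h1.fderiv
    rw [← hq.2, dx, dy, e1]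
    simp
  have h0 : ∀ v, HasD I (fun q => ((fderiv ℝ f q v : ℝ) : ℂ)) _ p := fun v =>
    ⟨(hv v).differentiableAt, rfl⟩
  have h1 := ((h0 (EuclideanSpace.single 0 1)).add
    ((h0 (EuclideanSpace.single 1 1)).const_mul (-I))).congr_of_eventuallyEq hF'
  have h2 := congrArg Complex.re (h1.2.symm.trans hb.2)
  simp only [dx, dy, (hv _).fderiv] at h2
  rw [InnerProductSpace.laplacian_eq_iteratedFDeriv_orthonormalBasis f
    (EuclideanSpace.basisFun (Fin 2) ℝ)]
  simp [iteratedFDeriv_two_apply] at h2 ⊢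
  linarith

/-- The quotient rule gives `△ ln f = (f f_{z z̄} - f_z f_z̄) / f²`, and `f_z̄ = conj f_z` because
`f` is real. Thus `hr` is a bilinear equation of Hirota type. -/
theorem laplacian_log_eq_of_hasD {f : Plane → ℝ} {F : Plane → ℂ} {b : ℂ} {p : Plane} {r : ℝ}
    (hf : ContDiffAt ℝ 2 f p) (h0 : f p ≠ 0)
    (hF : ∀ᶠ q in 𝓝 p, HasD (-I) (fun q => (f q : ℂ)) (F q) q) (hb : HasD I F b p)
    (hr : f p * b - F p * conj (F p) = r * (f p : ℂ) ^ 2) :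
    Laplacian.laplacian (fun q => Real.log (f q)) p = r := by
  refine laplacian_eq_of_hasD (F := fun q => (((f q)⁻¹ : ℝ) : ℂ) * F q) (hf.log h0) ?_ ?_
  · filter_upwards [hF, hf.continuousAt.eventually_ne h0] with q hq hq0
    exact hq.ofReal_comp (Real.hasDerivAt_log hq0)
  · have h1 := hF.self_of_nhds.conj_dz
    simp only [Complex.conj_ofReal] at h1
    refine ((h1.ofReal_comp (hasDerivAt_inv h0)).mul hb).congr_deriv ?_
    have h0' : (f p : ℂ) ≠ 0 := by exact_mod_cast h0
    push_cast
    field_simp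
    linear_combination hr

/-! ### Sums with weights `ρ ^ {k + i}` -/

theorem remN_congr {l : ℕ} {j k : ℤ} (h : (2 * (l : ℤ) - 1) ∣ j - k) : remN l j = remN l k := by
  rw [remN, remN, Int.emod_eq_emod_iff_emod_sub_eq_zero.2 (Int.emod_eq_zero_of_dvd h)]

theorem remN_add_one_of_dvd {l : ℕ} (hl : 1 ≤ l) {k : ℤ} (h : (2 * (l : ℤ) - 1) ∣ k + 1) :
    remN l (k + 1) = 0 ∧ remN l k + 1 = 2 * l - 1 := by
  have hk : k % (2 * (l : ℤ) - 1) = 2 * (l : ℤ) - 2 := by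
    rw [Int.emod_eq_emod_iff_emod_sub_eq_zero.2 (Int.emod_eq_zero_of_dvd
      (b := k - (2 * l - 2)) ?_)]
    · exact Int.emod_eq_of_lt (by omega) (by omega)
    · have := h.sub (dvd_refl (2 * (l : ℤ) - 1))
      ring_nf at this ⊢
      exact this
  constructor
  · simp [remN, Int.emod_eq_zero_of_dvd h]
  · rw [remN, hk]
    omega

theorem remN_add_one_of_not_dvd {l : ℕ} (hl : 1 ≤ l) {k : ℤ} (h : ¬ (2 * (l : ℤ) - 1) ∣ k + 1) :
    remN l (k + 1) = remN l k + 1 := by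
  have hpos : 0 < 2 * (l : ℤ) - 1 := by omega
  have h0 := Int.emod_nonneg k hpos.ne'
  have h1 := Int.emod_lt_of_pos k hpos
  have h2 : (k + 1) % (2 * (l : ℤ) - 1) = (k % (2 * (l : ℤ) - 1) + 1) % (2 * (l : ℤ) - 1) := by
    rw [Int.emod_add_emod]
  have h3 : k % (2 * (l : ℤ) - 1) + 1 ≠ 2 * (l : ℤ) - 1 := by
    intro h3
    rw [h3, Int.emod_self] at h2
    exact h (Int.dvd_of_emod_eq_zero h2)
  rw [remN, remN, h2, Int.emod_eq_of_lt (by omega) (by omega)]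
  omega

/-- Raising the argument of the remainder by one multiplies each weight by `ρ`, except at the index
`i₀`, where the remainder falls from `2l - 2` to `0`. That index produces the correction `1 - ρ ^
(2l - 1)`. -/
theorem sum_pow_remN_add_one {l : ℕ} (hl : 1 ≤ l) (ρ : ℂ) (x : ℕ → ℂ) {k : ℤ} {i₀ : ℕ}
    (hi : i₀ < 2 * l - 1) (hk : (2 * (l : ℤ) - 1) ∣ k + i₀ + 1) :
    ∑ i ∈ Finset.range (2 * l - 1), ρ ^ remN l (k + i + 1) * x i =
      ρ * ∑ i ∈ Finset.range (2 * l - 1), ρ ^ remN l (k + i) * x i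
        + (1 - ρ ^ (2 * l - 1)) * x i₀ := by
  have key : ∀ i ∈ Finset.range (2 * l - 1), ρ ^ remN l (k + i + 1) * x i =
      ρ * (ρ ^ remN l (k + i) * x i) + if i = i₀ then (1 - ρ ^ (2 * l - 1)) * x i₀ else 0 := by
    intro i hir
    have hir := Finset.mem_range.1 hir
    by_cases h : i = i₀
    · subst h
      obtain ⟨h1, h2⟩ := remN_add_one_of_dvd hl hk
      rw [if_pos rfl, h1, ← h2]
      ring
    · rw [if_neg h, remN_add_one_of_not_dvd hl]
      · ring
      · intro h'
        have h3 : (2 * (l : ℤ) - 1) ∣ (i : ℤ) - i₀ := by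
          have := h'.sub hk
          ring_nf at this ⊢
          exact this
        have h4 := Int.eq_zero_of_abs_lt_dvd h3 (by rw [abs_lt]; omega)
        omega
  rw [Finset.sum_congr rfl key, Finset.sum_add_distrib, ← Finset.mul_sum,
    Finset.sum_ite_eq' (Finset.range _), if_pos (Finset.mem_range.2 hi)]

/-- A weighted sum of `α xᵢ₊₁ + β xᵢ` with `α + β ρ = 0` telescopes cyclically. -/
theorem sum_pow_remN_telescope {l : ℕ} (hl : 1 ≤ l) {ρ α β : ℂ} (h : α + β * ρ = 0) {x : ℕ → ℂ}
    (hx : x (2 * l - 1) = x 0) {k : ℤ} {i₀ : ℕ}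
    (hi : i₀ < 2 * l - 1) (hk : (2 * (l : ℤ) - 1) ∣ k + i₀ + 1) :
    ∑ i ∈ Finset.range (2 * l - 1), ρ ^ remN l (k + i) * (α * x (i + 1) + β * x i) =
      β * (1 - ρ ^ (2 * l - 1)) * x (i₀ + 1) := by
  -- Weights and values are both periodic with period `2l - 1`, so the summation index may be
  -- shifted by one.
  have shift : ∑ i ∈ Finset.range (2 * l - 1), ρ ^ remN l (k + i) * x i =
      ∑ i ∈ Finset.range (2 * l - 1), ρ ^ remN l (k + i + 1) * x (i + 1) := by
    have h1 := Finset.sum_range_succ (fun i : ℕ => ρ ^ remN l (k + i) * x i) (2 * l - 1)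
    have h2 := Finset.sum_range_succ' (fun i : ℕ => ρ ^ remN l (k + i) * x i) (2 * l - 1)
    have h3 : remN l (k + (2 * l - 1 : ℕ)) = remN l (k + (0 : ℕ)) :=
      remN_congr ⟨1, by push_cast [show 1 ≤ 2 * l by omega]; ring⟩
    rw [h1] at h2
    simp only [h3, hx] at h2
    have h4 := add_right_cancel h2
    rw [h4]
    refine Finset.sum_congr rfl fun i _ => ?_
    push_cast
    rw [add_assoc]
  have h2 := sum_pow_remN_add_one hl ρ (fun i => x (i + 1)) hi hk
  simp only [mul_add, Finset.sum_add_distrib]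
  have e1 : ∀ (c : ℂ) (y : ℕ → ℂ),
      ∑ i ∈ Finset.range (2 * l - 1), ρ ^ remN l (k + i) * (c * y i) =
      c * ∑ i ∈ Finset.range (2 * l - 1), ρ ^ remN l (k + i) * y i := fun c y => by
    rw [Finset.mul_sum]
    exact Finset.sum_congr rfl fun i _ => by ring
  rw [e1 α fun i => x (i + 1), e1 β, shift, h2]
  linear_combination (∑ i ∈ Finset.range (2 * l - 1), ρ ^ remN l (k + i) * x (i + 1)) * h

/-! ### The Lax pair in components -/

/-- The exponent of `V` in the block `c`, for `2 ≤ c ≤ 2l - 1`. -/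
def vexp (l : ℕ) (u : ℕ → Plane → ℝ) (c : ℕ) (q : Plane) : ℝ :=
  if c ≤ l then u c q else -u (2 * l + 1 - c) q

/-- The antisymmetry of the exponents under `c ↦ 2 - c` modulo `2l - 1`, the source of the
cancellation of exponentials in all products of reflected blocks. -/
theorem vexp_reflect {l : ℕ} {u : ℕ → Plane → ℝ} {c : ℕ} (hc : c ≤ 2 * l) {q : Plane} :
    vexp l u (2 * l + 1 - c) q = -vexp l u c q := by
  unfold vexp
  split_ifs with h1 h2 h2
  · omega
  · simp
  · rw [show 2 * l + 1 - (2 * l + 1 - c) = c by omega]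
  · omega

/-- The block `c` of `V⁻¹ H`; its two entries are added up if `c = 1`. -/
noncomputable def kap (l : ℕ) (u : ℕ → Plane → ℝ) (h₁₁ h₁₂ : Plane → ℂ) (h : ℕ → Plane → ℂ)
    (c : ℕ) (q : Plane) : ℂ :=
  if c = 1 then Real.exp (-u 1 q) * h₁₁ q + Real.exp (u 1 q) * h₁₂ q
  else Real.exp (-vexp l u c q) * h c q

/-- The block `c` of `H`, where the block `2l` is the sum of the two entries of the block `1`. -/
def hext (l : ℕ) (h₁₁ h₁₂ : Plane → ℂ) (h : ℕ → Plane → ℂ) (c : ℕ) (q : Plane) : ℂ :=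
  if c = 2 * l then h₁₁ q + h₁₂ q else h c q

/-- The Lax pair at `p`, arranged so that no derivatives of `u` occur. -/
structure ReducedLax (l : ℕ) (μ : ℂ) (u : ℕ → Plane → ℝ) (h₁₁ h₁₂ : Plane → ℂ)
    (h : ℕ → Plane → ℂ) (p : Plane) : Prop where
  h₁₁_zbar : HasD I h₁₁ (μ⁻¹ * (Real.exp (u 1 p) * kap l u h₁₁ h₁₂ h (2 * l - 1) p)) p
  h₁₂_zbar : HasD I h₁₂ (μ⁻¹ * (Real.exp (-u 1 p) * kap l u h₁₁ h₁₂ h (2 * l - 1) p)) p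
  h_zbar : ∀ c, 2 ≤ c → c ≤ 2 * l - 1 →
    HasD I (h c) (μ⁻¹ * (Real.exp (vexp l u c p) * kap l u h₁₁ h₁₂ h (c - 1) p)) p
  k₁₁_z : HasD (-I) (fun q => Real.exp (-u 1 q) * h₁₁ q) (μ * (Real.exp (-u 1 p) * h 2 p)) p
  k₁₂_z : HasD (-I) (fun q => Real.exp (u 1 q) * h₁₂ q) (μ * (Real.exp (u 1 p) * h 2 p)) p
  kap_z : ∀ c, 2 ≤ c → c ≤ 2 * l - 1 → HasD (-I) (kap l u h₁₁ h₁₂ h c)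
    (μ * (Real.exp (-vexp l u c p) * hext l h₁₁ h₁₂ h (c + 1) p)) p

variable {l : ℕ} {μ : ℂ} {u : ℕ → Plane → ℝ} {h₁₁ h₁₂ : Plane → ℂ} {h : ℕ → Plane → ℂ}
  {p q : Plane}

theorem hext_of_lt {c : ℕ} (hc : c < 2 * l) : hext l h₁₁ h₁₂ h c q = h c q := by
  rw [hext, if_neg hc.ne]

theorem hext_two_mul : hext l h₁₁ h₁₂ h (2 * l) q = h₁₁ q + h₁₂ q := by
  rw [hext, if_pos rfl]

theorem kap_of_one_lt {c : ℕ} (hc : 1 < c) :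
    kap l u h₁₁ h₁₂ h c q = Real.exp (-vexp l u c q) * h c q := by
  rw [kap, if_neg hc.ne']

theorem kap_one :
    kap l u h₁₁ h₁₂ h 1 q = Real.exp (-u 1 q) * h₁₁ q + Real.exp (u 1 q) * h₁₂ q := by
  rw [kap, if_pos rfl]

/-! ### The functions `γ` -/

/-- The contribution of the block `c` to `γ`. -/
noncomputable def weight (l : ℕ) (u : ℕ → Plane → ℝ) (h₁₁ h₁₂ : Plane → ℂ) (h : ℕ → Plane → ℂ)
    (c : ℕ) (q : Plane) : ℂ :=
  if c = 1 then h₁₁ q * conj (Real.exp (-u 1 q) * h₁₁ q) + h₁₂ q * conj (Real.exp (u 1 q) * h₁₂ q)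
  else h c q * conj (kap l u h₁₁ h₁₂ h c q)

theorem weight_of_one_lt {c : ℕ} (hc : 1 < c) : weight l u h₁₁ h₁₂ h c q =
    h c q * conj (kap l u h₁₁ h₁₂ h c q) := by
  rw [weight, if_neg hc.ne']

/-- Because `2l - 1` is odd, the correction factor for the ratio `-|μ|²` is exactly the positive
constant by which `γ` is normalized. -/
theorem one_sub_neg_pow (hl : 1 ≤ l) (μ : ℂ) :
    1 - (-(μ * conj μ)) ^ (2 * l - 1) = ((1 + ‖μ‖ ^ (4 * l - 2) : ℝ) : ℂ) := by
  rw [Odd.neg_pow ⟨l - 1, by omega⟩, Complex.mul_conj', ← pow_mul,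
    show 2 * (2 * l - 1) = 4 * l - 2 by omega]
  push_cast
  ring

theorem one_sub_neg_pow_ne_zero (hl : 1 ≤ l) (μ : ℂ) :
    1 - (-(μ * conj μ)) ^ (2 * l - 1) ≠ 0 := by
  rw [one_sub_neg_pow hl]
  exact_mod_cast (by positivity : (1 + ‖μ‖ ^ (4 * l - 2) : ℝ) ≠ 0)

theorem sum_Icc_reflect {M : Type*} [AddCommMonoid M] (l : ℕ) (f : ℕ → M) :
    ∑ c ∈ Finset.Icc 2 l, f (2 * l + 1 - c) = ∑ c ∈ Finset.Icc (l + 1) (2 * l - 1), f c := by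
  refine Finset.sum_bij' (fun c _ => 2 * l + 1 - c) (fun c _ => 2 * l + 1 - c) ?_ ?_ ?_ ?_ ?_ <;>
    simp only [Finset.mem_Icc] <;> intros <;> first | omega | trivial

theorem gam_eq_sum (hl : 1 ≤ l) (j : ℤ) : (gam l μ u h₁₁ h₁₂ h j q : ℂ) =
    (1 - (-(μ * conj μ)) ^ (2 * l - 1))⁻¹ * ∑ i ∈ Finset.range (2 * l - 1),
      (-(μ * conj μ)) ^ remN l (j - 1 + i) * weight l u h₁₁ h₁₂ h (i + 1) q := by
  have split : ∀ f : ℕ → ℂ, ∑ i ∈ Finset.range (2 * l - 1), f (i + 1) =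
      f 1 + ∑ c ∈ Finset.Icc 2 l, f c + ∑ c ∈ Finset.Icc 2 l, f (2 * l + 1 - c) := by
    intro f
    rw [sum_Icc_reflect, add_assoc, ← Finset.Ico_add_one_right_eq_Icc,
      ← Finset.Ico_add_one_right_eq_Icc, Finset.sum_Ico_consecutive _ (by omega) (by omega),
      ← Finset.sum_eq_sum_Ico_succ_bot (by omega), Finset.sum_Ico_eq_sum_range]
    exact Finset.sum_congr rfl fun i _ => by rw [add_comm]
  have h0 := split fun c => (-(μ * conj μ)) ^ remN l (j + c - 2) * weight l u h₁₁ h₁₂ h c q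
  have h1 : ∀ i : ℕ, j - 1 + (i : ℤ) = j + (i + 1 : ℕ) - 2 := fun i => by push_cast; ring
  simp only [h1, h0, one_sub_neg_pow hl, gam]
  push_cast
  rw [one_div]
  simp only [← Complex.mul_conj']
  refine congrArg₂ _ rfl (congrArg₂ _ (congrArg₂ _ ?_ ?_) ?_)
  · rw [weight, if_pos rfl, map_mul, map_mul, Complex.conj_ofReal, Complex.conj_ofReal,
      show j + 1 - 2 = j - 1 by ring]
    push_cast
    ring
  · refine Finset.sum_congr rfl fun c hc => ?_
    rw [Finset.mem_Icc] at hc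
    rw [weight_of_one_lt (by omega), kap_of_one_lt (by omega), map_mul, Complex.conj_ofReal,
      vexp, if_pos hc.2]
    push_cast
    ring
  · refine Finset.sum_congr rfl fun c hc => ?_
    rw [Finset.mem_Icc] at hc
    rw [weight_of_one_lt (by omega), kap_of_one_lt (by omega), map_mul, Complex.conj_ofReal,
      vexp_reflect (by omega), vexp, if_pos hc.2, neg_neg,
      remN_congr (j := j - c) (k := j + (2 * l + 1 - c : ℕ) - 2)
        ⟨-1, by push_cast [show c ≤ 2 * l + 1 by omega]; ring⟩]
    push_cast
    ring

/-- The recursion `γ_{j+1} + |μ|² γ_j = w_{1-j}`. -/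
theorem gam_add_one (hl : 1 ≤ l) {j : ℤ} {c : ℕ} (h1 : 1 ≤ c) (h2 : c ≤ 2 * l - 1)
    (hc : (2 * (l : ℤ) - 1) ∣ j - 1 + c) :
    (gam l μ u h₁₁ h₁₂ h (j + 1) q : ℂ) + μ * conj μ * gam l μ u h₁₁ h₁₂ h j q =
      weight l u h₁₁ h₁₂ h c q := by
  have h3 := sum_pow_remN_add_one hl (-(μ * conj μ)) (fun i => weight l u h₁₁ h₁₂ h (i + 1) q)
    (k := j - 1) (i₀ := c - 1) (by omega) (by push_cast [h1]; ring_nf at hc ⊢; exact hc)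
  rw [gam_eq_sum hl, gam_eq_sum hl]
  have h4 := one_sub_neg_pow_ne_zero hl μ
  simp only [show c - 1 + 1 = c by omega] at h3
  simp only [show ∀ i : ℕ, j + 1 - 1 + (i : ℤ) = j - 1 + i + 1 by intro i; ring, h3]
  field_simp
  ring

theorem gam_congr {j k : ℤ} (hjk : (2 * (l : ℤ) - 1) ∣ j - k) :
    gam l μ u h₁₁ h₁₂ h j q = gam l μ u h₁₁ h₁₂ h k q := by
  have h1 : ∀ a : ℤ, remN l (j + a) = remN l (k + a) := fun a =>
    remN_congr (by simpa using hjk)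
  simp only [gam, sub_eq_add_neg, add_assoc, h1]

/-- A weight pairs `h_c`, whose `z̄`-derivative is known, with `conj κ_c`, whose `z̄`-derivative is
the conjugate of a known `z`-derivative. The exponentials cancel, leaving two consecutive terms of
one sequence. -/
theorem ReducedLax.weight_zbar (hp : ReducedLax l μ u h₁₁ h₁₂ h p) {c : ℕ} (h1 : 1 < c)
    (h2 : c ≤ 2 * l - 1) : HasD I (weight l u h₁₁ h₁₂ h c)
      (conj μ * (kap l u h₁₁ h₁₂ h c p * conj (hext l h₁₁ h₁₂ h (c + 1) p)) +
        μ⁻¹ * (kap l u h₁₁ h₁₂ h (c - 1) p * conj (hext l h₁₁ h₁₂ h c p))) p := by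
  have h3 := (hp.h_zbar c h1 h2).mul (hp.kap_z c h1 h2).conj_dz
  rw [show weight l u h₁₁ h₁₂ h c = _ from funext fun q => weight_of_one_lt h1]
  refine h3.congr_deriv ?_
  have h4 : (Real.exp (vexp l u c p) : ℂ) * Real.exp (-vexp l u c p) = 1 := by
    rw [← Complex.ofReal_mul, ← Real.exp_add]
    simp
  rw [hext_of_lt (c := c) (by omega), kap_of_one_lt h1]
  simp only [map_mul, Complex.conj_ofReal]
  linear_combination (μ⁻¹ * kap l u h₁₁ h₁₂ h (c - 1) p * conj (h c p)) * h4

theorem ReducedLax.weight_one_zbar (hl : 2 ≤ l) (hp : ReducedLax l μ u h₁₁ h₁₂ h p) :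
    HasD I (weight l u h₁₁ h₁₂ h 1)
      (conj μ * (kap l u h₁₁ h₁₂ h 1 p * conj (hext l h₁₁ h₁₂ h 2 p)) +
        μ⁻¹ * (kap l u h₁₁ h₁₂ h (2 * l - 1) p * conj (hext l h₁₁ h₁₂ h (2 * l) p))) p := by
  have h3 := (hp.h₁₁_zbar.mul hp.k₁₁_z.conj_dz).add (hp.h₁₂_zbar.mul hp.k₁₂_z.conj_dz)
  have h5 : weight l u h₁₁ h₁₂ h 1 = _ := funext fun q => if_pos rfl
  rw [h5]
  refine h3.congr_deriv ?_
  have h4 : (Real.exp (u 1 p) : ℂ) * Real.exp (-u 1 p) = 1 := by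
    rw [← Complex.ofReal_mul, ← Real.exp_add]
    simp
  rw [hext_of_lt (by omega), hext_two_mul, kap_one]
  simp only [map_mul, map_add, Complex.conj_ofReal]
  linear_combination (μ⁻¹ * kap l u h₁₁ h₁₂ h (2 * l - 1) p *
    (conj (h₁₁ p) + conj (h₁₂ p))) * h4

theorem ReducedLax.gam_zbar (hl : 2 ≤ l) (hμ : μ ≠ 0) (hp : ReducedLax l μ u h₁₁ h₁₂ h p)
    {j : ℤ} {c : ℕ} (h1 : 1 ≤ c) (h2 : c ≤ 2 * l - 1) (hc : (2 * (l : ℤ) - 1) ∣ j - 1 + c) :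
    HasD I (fun q => (gam l μ u h₁₁ h₁₂ h j q : ℂ))
      (μ⁻¹ * (kap l u h₁₁ h₁₂ h c p * conj (hext l h₁₁ h₁₂ h (c + 1) p))) p := by
  have hl1 : 1 ≤ l := by omega
  -- The sequence `κ_i conj h_{i+1}`; its value at `0` is set to that at `2l - 1`, as the cyclic
  -- telescoping requires.
  let x : ℕ → ℂ := fun i =>
    if i = 0 then kap l u h₁₁ h₁₂ h (2 * l - 1) p * conj (hext l h₁₁ h₁₂ h (2 * l) p)
    else kap l u h₁₁ h₁₂ h i p * conj (hext l h₁₁ h₁₂ h (i + 1) p)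
  have hx : ∀ i, i ≠ 0 → x i = kap l u h₁₁ h₁₂ h i p * conj (hext l h₁₁ h₁₂ h (i + 1) p) :=
    fun i hi => if_neg hi
  -- The ratio `-|μ|²` is the one that makes the sum telescope: `conj μ + μ⁻¹ (-|μ|²) = 0`.
  have h3 := sum_pow_remN_telescope hl1 (ρ := -(μ * conj μ)) (α := conj μ) (β := μ⁻¹)
    (by field_simp; ring) (x := x) (by
      rw [hx _ (by omega), show 2 * l - 1 + 1 = 2 * l by omega]; rfl)
    (k := j - 1) (i₀ := c - 1) (by omega) (by push_cast [h1]; ring_nf at hc ⊢; exact hc)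
  have h4 : ∀ i ∈ Finset.range (2 * l - 1), HasD I
      (fun q => (-(μ * conj μ)) ^ remN l (j - 1 + i) * weight l u h₁₁ h₁₂ h (i + 1) q)
      ((-(μ * conj μ)) ^ remN l (j - 1 + i) * (conj μ * x (i + 1) + μ⁻¹ * x i)) p := by
    intro i hi
    rw [Finset.mem_range] at hi
    refine HasD.const_mul _ ?_
    rcases Nat.eq_zero_or_pos i with rfl | hi0
    · exact (hp.weight_one_zbar hl).congr_deriv (by rw [hx _ (by omega)]; rfl)
    · exact (hp.weight_zbar (c := i + 1) (by omega) (by omega)).congr_deriv (by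
        rw [hx _ (by omega), hx _ (by omega)]; rfl)
  have h5 := (HasD.sum h4).const_mul (1 - (-(μ * conj μ)) ^ (2 * l - 1))⁻¹
  simp only [← gam_eq_sum hl1] at h5
  refine h5.congr_deriv ?_
  rw [h3, show c - 1 + 1 = c by omega, hx _ (by omega)]
  have h6 := one_sub_neg_pow_ne_zero hl1 μ
  field_simp

/-! ### The quadratic part of `g` -/

/-- The product `h_{2-c} h_c`, read as `2 h₁₁ h₁₂` if `c = 1`. -/
def pairing (l : ℕ) (h₁₁ h₁₂ : Plane → ℂ) (h : ℕ → Plane → ℂ) (c : ℕ) (q : Plane) : ℂ :=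
  if c = 1 then 2 * h₁₁ q * h₁₂ q else h (2 * l + 1 - c) q * h c q

/-- Up to sign, half of the sum whose square occurs in `g_j`. -/
noncomputable def gsum (l : ℕ) (h₁₁ h₁₂ : Plane → ℂ) (h : ℕ → Plane → ℂ) (j : ℤ) (q : Plane) : ℂ :=
  2⁻¹ * ∑ i ∈ Finset.range (2 * l - 1), (-1) ^ remN l (1 - j + i) * pairing l h₁₁ h₁₂ h (i + 1) q

theorem pairing_of_one_lt {c : ℕ} (hc : 1 < c) :
    pairing l h₁₁ h₁₂ h c q = h (2 * l + 1 - c) q * h c q := by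
  rw [pairing, if_neg hc.ne']

theorem remN_neg_one_sub (hl : 1 ≤ l) (k : ℤ) : remN l (-1 - k) + remN l k = 2 * l - 2 := by
  have hpos : 0 < 2 * (l : ℤ) - 1 := by omega
  have h0 := Int.emod_nonneg k hpos.ne'
  have h1 := Int.emod_lt_of_pos k hpos
  have h2 : (-1 - k) % (2 * (l : ℤ) - 1) = 2 * l - 1 - 1 - k % (2 * (l : ℤ) - 1) := by
    rw [← Int.emod_eq_of_lt (a := 2 * (l : ℤ) - 1 - 1 - k % (2 * (l : ℤ) - 1))
      (b := 2 * (l : ℤ) - 1) (by omega) (by omega)]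
    refine Int.emod_eq_emod_iff_emod_sub_eq_zero.2 (Int.emod_eq_zero_of_dvd ?_)
    have := Int.emod_add_mul_ediv k (2 * (l : ℤ) - 1)
    exact ⟨-1 - k / (2 * l - 1), by linear_combination this⟩
  rw [remN, remN, h2]
  omega

/-- The sign `(-1) ^ {1 - j}` is common to all terms and disappears in the absolute value; the
factor `1/4` is absorbed by the `2⁻¹` in `gsum`. -/
theorem g_eq (hl : 2 ≤ l) (j : ℤ) : (g l μ u h₁₁ h₁₂ h j q : ℂ) =
    gsum l h₁₁ h₁₂ h j q * conj (gsum l h₁₁ h₁₂ h j q) - μ * conj μ *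
      (gam l μ u h₁₁ h₁₂ h (j - 1) q * gam l μ u h₁₁ h₁₂ h (2 - j) q) := by
  have h1 : 2 * h₁₁ q * h₁₂ q + ∑ c ∈ Finset.Icc 2 (2 * l - 1),
      (-1 : ℂ) ^ ((remN l (c - j) : ℤ) - (remN l (1 - j) : ℤ)) *
        h (2 * l + 1 - c) q * h c q =
      (-1) ^ remN l (1 - j) * (2 * gsum l h₁₁ h₁₂ h j q) := by
    rw [gsum, mul_inv_cancel_left₀ two_ne_zero, ← Finset.Ico_add_one_right_eq_Icc,
      Finset.sum_Ico_eq_sum_range, show 2 * l - 1 = 2 * l - 1 + 1 - 2 + 1 by omega,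
      Finset.sum_range_succ', mul_add, Finset.mul_sum, add_comm]
    refine congrArg₂ _ (Finset.sum_congr (by congr 1) fun i _ => ?_) ?_
    · rw [pairing_of_one_lt (by omega), zpow_sub₀ (by norm_num), zpow_natCast, zpow_natCast,
        show i + 1 + 1 = 2 + i by ring,
        show ((2 + i : ℕ) : ℤ) - j = 1 - j + (i + 1 : ℕ) by push_cast; ring]
      rcases neg_one_pow_eq_or ℂ (remN l (1 - j)) with h2 | h2 <;> rw [h2] <;> ring
    · rcases neg_one_pow_eq_or ℂ (remN l (1 - j)) with h2 | h2 <;> simp [h2, pairing]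
  rw [g, h1, norm_mul, norm_mul, norm_pow, norm_neg, norm_one, one_pow, one_mul, mul_conj',
    mul_conj']
  push_cast
  simp
  ring

theorem gsum_add_one (hl : 1 ≤ l) {j : ℕ} (h1 : 1 ≤ j) (h2 : j ≤ 2 * l - 1) :
    gsum l h₁₁ h₁₂ h j q + gsum l h₁₁ h₁₂ h (j + 1) q = pairing l h₁₁ h₁₂ h j q := by
  have h3 := sum_pow_remN_add_one hl (-1) (fun i => pairing l h₁₁ h₁₂ h (i + 1) q)
    (k := -j) (i₀ := j - 1) (by omega) (by push_cast [h1]; ring_nf; exact dvd_zero _)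
  have h4 : Odd (2 * l - 1) := ⟨l - 1, by omega⟩
  simp only [show j - 1 + 1 = j by omega, h4.neg_one_pow] at h3
  simp only [gsum, show ∀ i : ℕ, (1 : ℤ) - j + i = -j + i + 1 by intro i; ring,
    show ∀ i : ℕ, (1 : ℤ) - (j + 1) + i = -j + i by intro i; ring, h3]
  ring

theorem gsum_congr {j k : ℤ} (hjk : (2 * (l : ℤ) - 1) ∣ j - k) :
    gsum l h₁₁ h₁₂ h j q = gsum l h₁₁ h₁₂ h k q := by
  have h1 : ∀ a : ℤ, remN l (1 - j + a) = remN l (1 - k + a) := fun a =>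
    remN_congr (by
      have := (dvd_neg (α := ℤ)).2 hjk
      ring_nf at this ⊢
      exact this)
  simp only [gsum, h1]

/-- The products are invariant under `c ↦ 2 - c`. This reflection pairs weights whose arguments add
up to `-1`, hence whose remainders add up to the even number `2l - 2`, so the signs agree. -/
theorem gsum_reflect (hl : 1 ≤ l) (j : ℤ) :
    gsum l h₁₁ h₁₂ h (3 - j) q = gsum l h₁₁ h₁₂ h j q := by
  have hs : ∀ k k' : ℤ, k + k' = -1 → (-1 : ℂ) ^ remN l k = (-1) ^ remN l k' := by
    intro k k' hk
    obtain rfl : k = -1 - k' := by omega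
    have h1 := remN_neg_one_sub hl k'
    have h2 : (-1 : ℂ) ^ remN l (-1 - k') * (-1) ^ remN l k' = 1 := by
      rw [← pow_add, h1]
      exact Even.neg_one_pow ⟨l - 1, by omega⟩
    rcases neg_one_pow_eq_or ℂ (remN l k') with h3 | h3 <;> rw [h3] at h2 ⊢
    · simpa using h2
    · linear_combination -h2
  rw [gsum, gsum, show 2 * l - 1 = 2 * l - 2 + 1 by omega, Finset.sum_range_succ',
    Finset.sum_range_succ', ← Finset.sum_range_reflect]
  refine congrArg₂ _ rfl (congrArg₂ _ (Finset.sum_congr rfl fun i hi => ?_) ?_)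
  · rw [Finset.mem_range] at hi
    rw [pairing_of_one_lt (by omega), pairing_of_one_lt (by omega),
      show 2 * l + 1 - (2 * l - 2 - 1 - i + 1 + 1) = i + 1 + 1 by omega,
      show 2 * l - 2 - 1 - i + 1 + 1 = 2 * l + 1 - (i + 1 + 1) by omega,
      remN_congr (j := 1 - (3 - j) + (2 * l - 2 - 1 - i + 1 : ℕ)) (k := j - 2 - (i + 1))
        ⟨1, by zify [show i ≤ 2 * l - 2 - 1 by omega, show 1 ≤ 2 * l - 2 by omega,
          show 2 ≤ 2 * l by omega]; ring⟩,
      hs _ (1 - j + (i + 1 : ℕ)) (by push_cast; ring)]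
    ring
  · rw [hs (1 - (3 - j) + (0 : ℕ)) (1 - j + (0 : ℕ)) (by push_cast; ring)]

/-- The reflection identifies the sums with index `1` and `2`, and together they give `2 h₁₁ h₁₂`.
-/
theorem gsum_two (hl : 1 ≤ l) : gsum l h₁₁ h₁₂ h 2 q = h₁₁ q * h₁₂ q := by
  have h1 := gsum_add_one (h₁₁ := h₁₁) (h₁₂ := h₁₂) (h := h) (q := q) hl le_rfl (by omega)
  have h2 := gsum_reflect (h₁₁ := h₁₁) (h₁₂ := h₁₂) (h := h) (q := q) hl 2
  norm_num [pairing] at h1 h2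
  linear_combination 2⁻¹ * h1 - 2⁻¹ * h2

/-- Modulo `2l - 1`, `l + 2` is the reflection `3 - l` of `l`; the two `γ` factors change places.
This closes the chain of bilinear identities at its far end. -/
theorem g_reflect (hl : 2 ≤ l) : g l μ u h₁₁ h₁₂ h (l + 2) q = g l μ u h₁₁ h₁₂ h l q := by
  have h1 : (g l μ u h₁₁ h₁₂ h (l + 2) q : ℂ) = g l μ u h₁₁ h₁₂ h l q := by
    rw [g_eq hl, g_eq hl, gsum_congr (j := l + 2) (k := 3 - l) ⟨1, by ring⟩,
      gsum_reflect (by omega), gam_congr (j := l + 2 - 1) (k := 2 - l) ⟨1, by ring⟩,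
      gam_congr (j := 2 - (l + 2)) (k := l - 1) ⟨-1, by ring⟩]
    ring
  exact_mod_cast h1

theorem exp_mul_exp_neg (x : ℝ) : (Real.exp x : ℂ) * Real.exp (-x) = 1 := by
  rw [← Complex.ofReal_mul, ← Real.exp_add]
  simp

/-- The same product is available in terms of `h`, suited to `∂_z̄`, and in terms of `κ`, suited to
`∂_z`. -/
theorem kap_mul_kap {c : ℕ} (h1 : 1 < c) (h2 : c ≤ 2 * l - 1) :
    kap l u h₁₁ h₁₂ h (2 * l + 1 - c) q * kap l u h₁₁ h₁₂ h c q = pairing l h₁₁ h₁₂ h c q := by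
  rw [kap_of_one_lt h1, kap_of_one_lt (by omega), pairing_of_one_lt h1,
    vexp_reflect (by omega), neg_neg]
  linear_combination h (2 * l + 1 - c) q * h c q * exp_mul_exp_neg (vexp l u c q)

theorem ReducedLax.gsum_z (hl : 2 ≤ l) (hp : ReducedLax l μ u h₁₁ h₁₂ h p) {j : ℕ}
    (h1 : 2 ≤ j) (h2 : j ≤ 2 * l) : HasD (-I) (gsum l h₁₁ h₁₂ h j)
      (μ * (hext l h₁₁ h₁₂ h (2 * l + 2 - j) p * hext l h₁₁ h₁₂ h j p)) p := by
  have hl1 : 1 ≤ l := by omega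
  let x : ℕ → ℂ := fun i =>
    if i = 0 then hext l h₁₁ h₁₂ h 2 p * hext l h₁₁ h₁₂ h (2 * l) p
    else hext l h₁₁ h₁₂ h (2 * l + 1 - i) p * hext l h₁₁ h₁₂ h (i + 1) p
  have hx : ∀ i, i ≠ 0 → x i =
      hext l h₁₁ h₁₂ h (2 * l + 1 - i) p * hext l h₁₁ h₁₂ h (i + 1) p := fun i hi => if_neg hi
  -- The wrap-around index is `i₀ = j - 2`, as `(1 - j) + i₀ + 1 = 0`.
  have h3 := sum_pow_remN_telescope hl1 (ρ := -1) (α := μ) (β := μ) (by ring) (x := x) (by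
      rw [hx _ (by omega), show 2 * l - 1 + 1 = 2 * l by omega,
        show 2 * l + 1 - (2 * l - 1) = 2 by omega]; rfl)
    (k := 1 - j) (i₀ := j - 2) (by omega) ⟨0, by push_cast [h1]; ring⟩
  have h4 : ∀ i ∈ Finset.range (2 * l - 1), HasD (-I)
      (fun q => (-1) ^ remN l (1 - j + i) * pairing l h₁₁ h₁₂ h (i + 1) q)
      ((-1) ^ remN l (1 - j + i) * (μ * x (i + 1) + μ * x i)) p := by
    intro i hi
    rw [Finset.mem_range] at hi
    refine HasD.const_mul _ ?_
    rcases Nat.eq_zero_or_pos i with rfl | hi0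
    · have e : pairing l h₁₁ h₁₂ h (0 + 1) = fun q => 2 * ((Real.exp (-u 1 q) * h₁₁ q) *
          (Real.exp (u 1 q) * h₁₂ q)) := funext fun q => by
        rw [pairing, if_pos (by norm_num)]
        linear_combination -2 * h₁₁ q * h₁₂ q * exp_mul_exp_neg (u 1 q)
      rw [e]
      refine ((hp.k₁₁_z.mul hp.k₁₂_z).const_mul 2).congr_deriv ?_
      rw [hx _ (by omega), show x 0 = _ from if_pos rfl, zero_add, Nat.add_sub_cancel, hext_two_mul,
        hext_of_lt (by omega)]
      linear_combination 2 * μ * h 2 p * (h₁₁ p + h₁₂ p) * exp_mul_exp_neg (u 1 p)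
    · have e : pairing l h₁₁ h₁₂ h (i + 1) = fun q => kap l u h₁₁ h₁₂ h (2 * l + 1 - (i + 1)) q *
          kap l u h₁₁ h₁₂ h (i + 1) q := funext fun q => (kap_mul_kap (by omega) (by omega)).symm
      rw [e]
      refine ((hp.kap_z _ (by omega) (by omega)).mul
        (hp.kap_z _ (by omega) (by omega))).congr_deriv ?_
      rw [hx _ (by omega), hx _ (by omega), kap_of_one_lt (by omega), kap_of_one_lt (by omega),
        vexp_reflect (by omega), neg_neg,
        show 2 * l + 1 - (i + 1) + 1 = 2 * l + 1 - i by omega,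
        hext_of_lt (c := i + 1) (by omega), hext_of_lt (c := 2 * l + 1 - (i + 1)) (by omega)]
      linear_combination μ * (h (2 * l + 1 - (i + 1)) p * hext l h₁₁ h₁₂ h (i + 1 + 1) p +
        hext l h₁₁ h₁₂ h (2 * l + 1 - i) p * h (i + 1) p) *
          exp_mul_exp_neg (vexp l u (i + 1) p)
  refine ((HasD.sum h4).const_mul 2⁻¹).congr_deriv ?_
  rw [h3, hx _ (by omega), Odd.neg_one_pow ⟨l - 1, by omega⟩, show j - 2 + 1 + 1 = j by omega,
    show 2 * l + 1 - (j - 2 + 1) = 2 * l + 2 - j by omega]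
  ring

theorem ReducedLax.gsum_zbar (hl : 2 ≤ l) (hp : ReducedLax l μ u h₁₁ h₁₂ h p) {j : ℕ}
    (h1 : 2 ≤ j) (h2 : j ≤ 2 * l) : HasD I (gsum l h₁₁ h₁₂ h j)
      (μ⁻¹ * (kap l u h₁₁ h₁₂ h (j - 1) p * kap l u h₁₁ h₁₂ h (2 * l + 1 - j) p)) p := by
  have hl1 : 1 ≤ l := by omega
  let x : ℕ → ℂ := fun i =>
    if i = 0 then kap l u h₁₁ h₁₂ h (2 * l - 1) p * kap l u h₁₁ h₁₂ h 1 p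
    else kap l u h₁₁ h₁₂ h i p * kap l u h₁₁ h₁₂ h (2 * l - i) p
  have hx : ∀ i, i ≠ 0 → x i =
      kap l u h₁₁ h₁₂ h i p * kap l u h₁₁ h₁₂ h (2 * l - i) p := fun i hi => if_neg hi
  have h3 := sum_pow_remN_telescope hl1 (ρ := -1) (α := μ⁻¹) (β := μ⁻¹) (by ring) (x := x) (by
      rw [hx _ (by omega), show 2 * l - (2 * l - 1) = 1 by omega]; rfl)
    (k := 1 - j) (i₀ := j - 2) (by omega) ⟨0, by push_cast [h1]; ring⟩
  have h4 : ∀ i ∈ Finset.range (2 * l - 1), HasD I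
      (fun q => (-1) ^ remN l (1 - j + i) * pairing l h₁₁ h₁₂ h (i + 1) q)
      ((-1) ^ remN l (1 - j + i) * (μ⁻¹ * x (i + 1) + μ⁻¹ * x i)) p := by
    intro i hi
    rw [Finset.mem_range] at hi
    refine HasD.const_mul _ ?_
    rcases Nat.eq_zero_or_pos i with rfl | hi0
    · have e : pairing l h₁₁ h₁₂ h (0 + 1) = fun q => 2 * (h₁₁ q * h₁₂ q) := funext fun q => by
        rw [pairing, if_pos (by norm_num)]
        ring
      rw [e]
      refine ((hp.h₁₁_zbar.mul hp.h₁₂_zbar).const_mul 2).congr_deriv ?_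
      rw [hx _ (by omega), show x 0 = _ from if_pos rfl, zero_add, kap_one]
      ring
    · have e : pairing l h₁₁ h₁₂ h (i + 1) = fun q => h (2 * l + 1 - (i + 1)) q * h (i + 1) q :=
        funext fun q => pairing_of_one_lt (by omega)
      rw [e]
      refine ((hp.h_zbar _ (by omega) (by omega)).mul
        (hp.h_zbar _ (by omega) (by omega))).congr_deriv ?_
      rw [hx _ (by omega), hx _ (by omega), vexp_reflect (by omega),
        show 2 * l + 1 - (i + 1) - 1 = 2 * l - (i + 1) by omega, Nat.add_sub_cancel,
        kap_of_one_lt (c := i + 1) (by omega), kap_of_one_lt (c := 2 * l - i) (by omega),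
        show 2 * l - i = 2 * l + 1 - (i + 1) by omega, vexp_reflect (by omega), neg_neg]
      ring
  refine ((HasD.sum h4).const_mul 2⁻¹).congr_deriv ?_
  rw [h3, hx _ (by omega), Odd.neg_one_pow ⟨l - 1, by omega⟩, show j - 2 + 1 = j - 1 by omega,
    show 2 * l - (j - 1) = 2 * l + 1 - j by omega]
  ring

/-! ### Bilinear identities -/

theorem ReducedLax.g_z (hl : 3 ≤ l) (hμ : μ ≠ 0) (hp : ReducedLax l μ u h₁₁ h₁₂ h p) {j : ℕ}
    (h1 : 3 ≤ j) (h2 : j ≤ l + 1) : HasD (-I) (fun q => (g l μ u h₁₁ h₁₂ h j q : ℂ))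
      (μ * (h (2 * l + 2 - j) p * h j p) * conj (gsum l h₁₁ h₁₂ h j p) +
        gsum l h₁₁ h₁₂ h j p * ((conj μ)⁻¹ * (conj (kap l u h₁₁ h₁₂ h (j - 1) p) *
          conj (kap l u h₁₁ h₁₂ h (2 * l + 1 - j) p))) -
        μ * (h (2 * l + 2 - j) p * conj (kap l u h₁₁ h₁₂ h (2 * l + 1 - j) p) *
            gam l μ u h₁₁ h₁₂ h (2 - j) p +
          gam l μ u h₁₁ h₁₂ h (j - 1) p * (h j p * conj (kap l u h₁₁ h₁₂ h (j - 1) p)))) p := by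
  have e1 := hp.gsum_z (j := j) (by omega) (by omega) (by omega)
  have e2 := (hp.gsum_zbar (j := j) (by omega) (by omega) (by omega)).conj_dzbar
  have e3 := (hp.gam_zbar (j := j - 1) (c := 2 * l + 1 - j) (by omega) hμ (by omega) (by omega)
    ⟨1, by zify [show j ≤ 2 * l + 1 by omega]; ring⟩).conj_dzbar
  have e4 := (hp.gam_zbar (j := 2 - j) (c := j - 1) (by omega) hμ (by omega) (by omega)
    ⟨0, by zify [show 1 ≤ j by omega]; ring⟩).conj_dzbar
  simp only [Complex.conj_ofReal] at e3 e4
  have e5 := (e1.mul e2).sub ((e3.mul e4).const_mul (μ * conj μ))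
  simp only [← g_eq (show 2 ≤ l by omega)] at e5
  refine e5.congr_deriv ?_
  have hμ' : conj μ ≠ 0 := by simpa using hμ
  rw [hext_of_lt (by omega), hext_of_lt (by omega), hext_of_lt (by omega), hext_of_lt (by omega),
    show 2 * l + 1 - j + 1 = 2 * l + 2 - j by omega, show j - 1 + 1 = j by omega]
  simp only [map_mul, map_inv₀, Complex.conj_conj]
  field_simp

/-- The Hirota identity with primed letters for conjugates, treated as independent variables: `a, b,
c, d` stand for `h_{j-1}, h_j, h_{2-j}, h_{3-j}`, `s, t` for `e^{v_{j-1}}, e^{v_j}`, `G` for `G_j`,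
and `x, y` for `γ_{j-1}, γ_{2-j}`. -/
theorem bilinear_algebra {μ ν a b c d G a' b' c' d' G' s t x y : ℂ} (hμ : μ ≠ 0) (hν : ν ≠ 0)
    (hs : s ≠ 0) (ht : t ≠ 0) :
    (G * G' - μ * ν * (x * y)) *
      (μ * (μ⁻¹ * (s⁻¹ * (t * c)) * b + d * (μ⁻¹ * (t * (s⁻¹ * a)))) * G' +
        μ * (d * b) * (ν * (d' * b')) +
        (μ⁻¹ * ((s⁻¹ * a) * (t * c)) * (ν⁻¹ * ((s⁻¹ * a') * (t * c'))) +
        G * (ν⁻¹ * (ν * (s⁻¹ * b') * (t * c') + (s⁻¹ * a') * (ν * (t * d'))))) -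
        μ * ((μ⁻¹ * (s⁻¹ * (t * c)) * (t * c') + d * (ν * (t * d'))) * y +
            d * (t * c') * (μ⁻¹ * ((s⁻¹ * a) * b')) +
          (μ⁻¹ * ((t * c) * d') * (b * (s⁻¹ * a')) +
            x * (μ⁻¹ * (t * (s⁻¹ * a)) * (s⁻¹ * a') + b * (ν * (s⁻¹ * b')))))) -
      (μ * (d * b) * G' + G * (ν⁻¹ * ((s⁻¹ * a') * (t * c'))) -
        μ * (d * (t * c') * y + x * (b * (s⁻¹ * a')))) *
      (ν * (d' * b') * G + G' * (μ⁻¹ * ((s⁻¹ * a) * (t * c))) -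
        ν * (d' * (t * c) * y + x * (b' * (s⁻¹ * a)))) =
    t * s⁻¹ * ((G * G' - μ * ν * (x * y)) ^ 2 -
      ((c * b - G) * (c' * b' - G') -
        (c * (t * c') - μ * ν * x) * (b * (t⁻¹ * b') - y)) *
      ((d * a - G) * (d' * a' - G') -
        (d * (s * d') - x) * (a * (s⁻¹ * a') - μ * ν * y))) := by
  field_simp
  ring

/-- The recursions for `G` and `γ` eliminate the neighbouring values, so that `g_{j+1}`, and
likewise `g_{j-1}` below, is written in the same `G_j`, `γ_{j-1}`, `γ_{2-j}` as `g_j`. -/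
theorem g_add_one_eq (hl : 3 ≤ l) {j : ℕ} (h1 : 3 ≤ j) (h2 : j ≤ l + 1) :
    (g l μ u h₁₁ h₁₂ h (j + 1) q : ℂ) =
      (h (2 * l + 1 - j) q * h j q - gsum l h₁₁ h₁₂ h j q) *
        (conj (h (2 * l + 1 - j) q) * conj (h j q) - conj (gsum l h₁₁ h₁₂ h j q)) -
      (h (2 * l + 1 - j) q * conj (kap l u h₁₁ h₁₂ h (2 * l + 1 - j) q) -
        μ * conj μ * gam l μ u h₁₁ h₁₂ h (j - 1) q) *
      (h j q * conj (kap l u h₁₁ h₁₂ h j q) - gam l μ u h₁₁ h₁₂ h (2 - j) q) := by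
  have e1 := gam_add_one (μ := μ) (u := u) (h₁₁ := h₁₁) (h₁₂ := h₁₂) (h := h) (q := q)
    (j := j - 1) (c := 2 * l + 1 - j) (show 1 ≤ l by omega) (by omega) (by omega)
    ⟨1, by zify [show j ≤ 2 * l + 1 by omega]; ring⟩
  have e2 := gam_add_one (μ := μ) (u := u) (h₁₁ := h₁₁) (h₁₂ := h₁₂) (h := h) (q := q)
    (j := 1 - j) (c := j) (show 1 ≤ l by omega) (by omega) (by omega) ⟨0, by ring⟩
  have e3 := gsum_add_one (h₁₁ := h₁₁) (h₁₂ := h₁₂) (h := h) (q := q) (j := j)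
    (show 1 ≤ l by omega) (by omega) (by omega)
  rw [weight_of_one_lt (by omega)] at e1 e2
  rw [pairing_of_one_lt (by omega)] at e3
  rw [g_eq (by omega), eq_sub_of_add_eq' e3, show (j : ℤ) + 1 - 1 = j - 1 + 1 by ring,
    eq_sub_of_add_eq e1, show 2 - ((j : ℤ) + 1) = 1 - j by ring, map_sub, map_mul]
  rw [show 1 - (j : ℤ) + 1 = 2 - j by ring] at e2
  linear_combination (-(h (2 * l + 1 - j) q * conj (kap l u h₁₁ h₁₂ h (2 * l + 1 - j) q) -
        μ * conj μ * gam l μ u h₁₁ h₁₂ h (j - 1) q)) * e2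

theorem g_sub_one_eq (hl : 3 ≤ l) {j : ℕ} (h1 : 3 ≤ j) (h2 : j ≤ l + 1) :
    (g l μ u h₁₁ h₁₂ h (j - 1) q : ℂ) =
      (h (2 * l + 2 - j) q * h (j - 1) q - gsum l h₁₁ h₁₂ h j q) *
        (conj (h (2 * l + 2 - j) q) * conj (h (j - 1) q) - conj (gsum l h₁₁ h₁₂ h j q)) -
      (h (2 * l + 2 - j) q * conj (kap l u h₁₁ h₁₂ h (2 * l + 2 - j) q) -
        gam l μ u h₁₁ h₁₂ h (j - 1) q) *
      (h (j - 1) q * conj (kap l u h₁₁ h₁₂ h (j - 1) q) -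
        μ * conj μ * gam l μ u h₁₁ h₁₂ h (2 - j) q) := by
  have e1 := gam_add_one (μ := μ) (u := u) (h₁₁ := h₁₁) (h₁₂ := h₁₂) (h := h) (q := q)
    (j := j - 2) (c := 2 * l + 2 - j) (show 1 ≤ l by omega) (by omega) (by omega)
    ⟨1, by zify [show j ≤ 2 * l + 2 by omega]; ring⟩
  have e2 := gam_add_one (μ := μ) (u := u) (h₁₁ := h₁₁) (h₁₂ := h₁₂) (h := h) (q := q)
    (j := 2 - j) (c := j - 1) (show 1 ≤ l by omega) (by omega) (by omega)
    ⟨0, by zify [show 1 ≤ j by omega]; ring⟩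
  have e3 := gsum_add_one (h₁₁ := h₁₁) (h₁₂ := h₁₂) (h := h) (q := q) (j := j - 1)
    (show 1 ≤ l by omega) (by omega) (by omega)
  rw [weight_of_one_lt (by omega)] at e1 e2
  rw [pairing_of_one_lt (by omega), show 2 * l + 1 - (j - 1) = 2 * l + 2 - j by omega,
    Nat.cast_sub (by omega), Nat.cast_one, sub_add_cancel] at e3
  rw [g_eq (by omega), eq_sub_of_add_eq e3, show (j : ℤ) - 1 - 1 = j - 2 by ring,
    show 2 - ((j : ℤ) - 1) = 2 - j + 1 by ring, eq_sub_of_add_eq e2, map_sub, map_mul]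
  rw [show (j : ℤ) - 2 + 1 = j - 1 by ring] at e1
  linear_combination (-(h (j - 1) q * conj (kap l u h₁₁ h₁₂ h (j - 1) q) -
        μ * conj μ * gam l μ u h₁₁ h₁₂ h (2 - j) q)) * e1

theorem laplacian_log_g (hl : 3 ≤ l) (hμ : μ ≠ 0)
    (hp : ∀ᶠ q in 𝓝 p, ReducedLax l μ u h₁₁ h₁₂ h q) {j : ℕ} (h1 : 3 ≤ j) (h2 : j ≤ l + 1)
    (hg : ContDiffAt ℝ 2 (g l μ u h₁₁ h₁₂ h j) p) (h0 : g l μ u h₁₁ h₁₂ h j p ≠ 0) :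
    Laplacian.laplacian (fun q => Real.log (g l μ u h₁₁ h₁₂ h j q)) p =
      Real.exp (vexp l u j p - vexp l u (j - 1) p) *
        (1 - g l μ u h₁₁ h₁₂ h (j + 1) p * g l μ u h₁₁ h₁₂ h (j - 1) p /
          g l μ u h₁₁ h₁₂ h j p ^ 2) := by
  have hp0 := hp.self_of_nhds
  have d1 := hp0.h_zbar (2 * l + 2 - j) (by omega) (by omega)
  have d2 := hp0.h_zbar j (by omega) (by omega)
  have d3 := (hp0.kap_z (2 * l + 1 - j) (by omega) (by omega)).conj_dz
  have d4 := (hp0.kap_z (j - 1) (by omega) (by omega)).conj_dz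
  have d5 := hp0.gsum_zbar (j := j) (by omega) (by omega) (by omega)
  have d6 := (hp0.gsum_z (j := j) (by omega) (by omega) (by omega)).conj_dz
  have d7 := hp0.gam_zbar (j := j - 1) (c := 2 * l + 1 - j) (by omega) hμ (by omega) (by omega)
    ⟨1, by zify [show j ≤ 2 * l + 1 by omega]; ring⟩
  have d8 := hp0.gam_zbar (j := 2 - j) (c := j - 1) (by omega) hμ (by omega) (by omega)
    ⟨0, by zify [show 1 ≤ j by omega]; ring⟩
  -- The formula for `∂_z g_j` is a polynomial in quantities whose `z̄`-derivatives are all known,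
  -- so it can be differentiated once more.
  have hF := ((((d1.mul d2).const_mul μ).mul d6).add
    (d5.mul ((d4.mul d3).const_mul (conj μ)⁻¹))).sub
    ((((d1.mul d3).mul d8).add (d7.mul (d2.mul d4))).const_mul μ)
  refine laplacian_log_eq_of_hasD hg h0 (hp.mono fun q hq => hq.g_z hl hμ h1 h2) hF ?_
  have hμ' : conj μ ≠ 0 := by simpa using hμ
  have h0' : (g l μ u h₁₁ h₁₂ h j p : ℂ) ≠ 0 := by exact_mod_cast h0
  have v1 : vexp l u (2 * l + 1 - j) p = -vexp l u j p := vexp_reflect (by omega)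
  have v2 : vexp l u (2 * l + 2 - j) p = -vexp l u (j - 1) p := by
    rw [← vexp_reflect (by omega)]
    congr 1
    omega
  have hr : ((Real.exp (vexp l u j p - vexp l u (j - 1) p) *
        (1 - g l μ u h₁₁ h₁₂ h (j + 1) p * g l μ u h₁₁ h₁₂ h (j - 1) p /
          g l μ u h₁₁ h₁₂ h j p ^ 2) : ℝ) : ℂ) * (g l μ u h₁₁ h₁₂ h j p : ℂ) ^ 2 =
      (Real.exp (vexp l u j p) : ℂ) * (Real.exp (vexp l u (j - 1) p) : ℂ)⁻¹ *
        ((g l μ u h₁₁ h₁₂ h j p : ℂ) ^ 2 -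
          g l μ u h₁₁ h₁₂ h (j + 1) p * g l μ u h₁₁ h₁₂ h (j - 1) p) := by
    rw [Real.exp_sub]
    push_cast
    field_simp
  rw [hr, g_add_one_eq hl h1 h2, g_sub_one_eq hl h1 h2, g_eq (by omega)]
  rw [show 2 * l + 2 - j - 1 = 2 * l + 1 - j by omega,
    show 2 * l + 1 - j + 1 = 2 * l + 2 - j by omega, show j - 1 + 1 = j by omega,
    hext_of_lt (by omega), hext_of_lt (by omega),
    kap_of_one_lt (c := j) (by omega), kap_of_one_lt (c := j - 1) (by omega),
    kap_of_one_lt (c := 2 * l + 1 - j) (by omega), kap_of_one_lt (c := 2 * l + 2 - j) (by omega),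
    v1, v2]
  simp only [neg_neg, Real.exp_neg, map_sub, map_add, map_mul, map_inv₀, Complex.conj_conj,
    Complex.conj_ofReal, Complex.ofReal_inv]
  refine Eq.trans ?_ (bilinear_algebra hμ hμ' (by exact_mod_cast (Real.exp_pos _).ne')
    (by exact_mod_cast (Real.exp_pos _).ne'))
  ring

/-! ### The end of the chain at the block of size two -/

theorem weight_one : weight l u h₁₁ h₁₂ h 1 q =
    ((‖h₁₁ q‖ ^ 2 * Real.exp (-u 1 q) + ‖h₁₂ q‖ ^ 2 * Real.exp (u 1 q) : ℝ) : ℂ) := by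
  rw [weight, if_pos rfl]
  simp only [map_mul, Complex.conj_ofReal, Complex.ofReal_add, Complex.ofReal_mul,
    Complex.ofReal_pow, ← Complex.mul_conj']
  ring

/-- Put `A = |h₁₁|² e^{-u₁}` and `B = |h₁₂|² e^{u₁}`. Then `|G_2|² = A B` and `|μ|² γ_0 = A + B -
γ_1`, so `g_2 = A B - γ_1 (A + B - γ_1)`, which factors. -/
theorem g_two (hl : 2 ≤ l) : g l μ u h₁₁ h₁₂ h 2 q =
    (‖h₁₁ q‖ ^ 2 * Real.exp (-u 1 q) - gam l μ u h₁₁ h₁₂ h 1 q) *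
      (‖h₁₂ q‖ ^ 2 * Real.exp (u 1 q) - gam l μ u h₁₁ h₁₂ h 1 q) := by
  have e1 := gam_add_one (μ := μ) (u := u) (h₁₁ := h₁₁) (h₁₂ := h₁₂) (h := h) (q := q)
    (j := 0) (c := 1) (show 1 ≤ l by omega) (by omega) (by omega) ⟨0, by norm_num⟩
  have e2 := g_eq (μ := μ) (u := u) (h₁₁ := h₁₁) (h₁₂ := h₁₂) (h := h) (q := q) hl 2
  have e3 := exp_mul_exp_neg (u 1 q)
  have key : (g l μ u h₁₁ h₁₂ h 2 q : ℂ) = (((‖h₁₁ q‖ ^ 2 * Real.exp (-u 1 q) -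
      gam l μ u h₁₁ h₁₂ h 1 q) * (‖h₁₂ q‖ ^ 2 * Real.exp (u 1 q) -
        gam l μ u h₁₁ h₁₂ h 1 q) : ℝ) : ℂ) := by
    rw [weight_one] at e1
    rw [e2, gsum_two (by omega), map_mul]
    rw [show (2 : ℤ) - 1 = 1 by norm_num, sub_self]
    rw [zero_add] at e1
    simp only [Complex.ofReal_add, Complex.ofReal_sub, Complex.ofReal_mul, Complex.ofReal_pow,
      ← Complex.mul_conj'] at e1 ⊢
    linear_combination (-gam l μ u h₁₁ h₁₂ h 1 q : ℂ) * e1 -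
      h₁₁ q * conj (h₁₁ q) * h₁₂ q * conj (h₁₂ q) * e3
  exact_mod_cast key

theorem g_three (hl : 3 ≤ l) (hμ : μ ≠ 0) : (g l μ u h₁₁ h₁₂ h 3 q : ℂ) =
    (h (2 * l - 1) q * h 2 q - h₁₁ q * h₁₂ q) *
        (conj (h (2 * l - 1) q) * conj (h 2 q) - conj (h₁₁ q) * conj (h₁₂ q)) -
      (h (2 * l - 1) q * conj (kap l u h₁₁ h₁₂ h (2 * l - 1) q) -
        μ * conj μ * gam l μ u h₁₁ h₁₂ h 1 q) *
      (h 2 q * conj (kap l u h₁₁ h₁₂ h 2 q) - (μ * conj μ)⁻¹ *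
        (weight l u h₁₁ h₁₂ h 1 q - gam l μ u h₁₁ h₁₂ h 1 q)) := by
  have e1 := gam_add_one (μ := μ) (u := u) (h₁₁ := h₁₁) (h₁₂ := h₁₂) (h := h) (q := q)
    (j := 1) (c := 2 * l - 1) (show 1 ≤ l by omega) (by omega) (by omega)
    ⟨1, by zify [show 1 ≤ 2 * l by omega]; ring⟩
  have e2 := gam_add_one (μ := μ) (u := u) (h₁₁ := h₁₁) (h₁₂ := h₁₂) (h := h) (q := q)
    (j := 0) (c := 1) (show 1 ≤ l by omega) (by omega) (by omega) ⟨0, by norm_num⟩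
  have e3 := gam_add_one (μ := μ) (u := u) (h₁₁ := h₁₁) (h₁₂ := h₁₂) (h := h) (q := q)
    (j := -1) (c := 2) (show 1 ≤ l by omega) (by omega) (by omega) ⟨0, by norm_num⟩
  have e4 := gsum_add_one (h₁₁ := h₁₁) (h₁₂ := h₁₂) (h := h) (q := q) (j := 2)
    (show 1 ≤ l by omega) (by omega) (by omega)
  rw [weight_of_one_lt (by omega)] at e1 e3
  rw [pairing_of_one_lt (by omega), show 2 * l + 1 - 2 = 2 * l - 1 by omega] at e4
  have hμ' : conj μ ≠ 0 := by simpa using hμ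
  norm_num at e1 e2 e3 e4
  rw [gsum_two (by omega)] at e4
  rw [g_eq (by omega), eq_sub_of_add_eq' e4, ← e1, ← e2, ← e3, map_sub, map_mul, map_mul]
  norm_num
  field_simp
  ring

/-- The counterpart of `bilinear_algebra` at the double block: `a, c` are its two entries, `b, f`
stand for `h_2, h_{2l-1}`, `e, t` for `e^w, e^{u_2}`, and `x` for `γ_1`. -/
theorem boundary_algebra {μ ν a b c f a' b' c' f' e t x : ℂ} (hμ : μ ≠ 0) (hν : ν ≠ 0)
    (he : e ≠ 0) (ht : t ≠ 0) :
    (a * (e⁻¹ * a') - x) * (μ * (μ⁻¹ * (t * (e⁻¹ * a + e * c)) * (e⁻¹ * a') +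
        b * (ν * (e⁻¹ * b'))) - ν⁻¹ * (μ⁻¹ * (e⁻¹ * (t * f)) * (t * f') +
        c * (ν * (t * (a' + c'))))) -
      (μ * (b * (e⁻¹ * a')) - ν⁻¹ * (c * (t * f'))) *
        (ν * (b' * (e⁻¹ * a)) - μ⁻¹ * (c' * (t * f))) =
    t * e⁻¹ * ((a * (e⁻¹ * a') - x) ^ 2 - ((f * b - a * c) * (f' * b' - a' * c') -
      (f * (t * f') - μ * ν * x) * (b * (t⁻¹ * b') -
        (μ * ν)⁻¹ * (a * (e⁻¹ * a') + c * (e * c') - x)))) := by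
  field_simp
  ring

/-- The Laplacian of the logarithm of numerator and denominator of the factor of `e^{u₁}`. The
functions `a` and `c` are `h₁₁` and `h₁₂` in any order. -/
theorem laplacian_log_boundary (hl : 3 ≤ l) (hμ : μ ≠ 0)
    (hp : ∀ᶠ q in 𝓝 p, ReducedLax l μ u h₁₁ h₁₂ h q) {a c : Plane → ℂ} {w : Plane → ℝ}
    (ha : ∀ᶠ q in 𝓝 p,
      HasD I a (μ⁻¹ * (Real.exp (w q) * kap l u h₁₁ h₁₂ h (2 * l - 1) q)) q)
    (hc : HasD I c (μ⁻¹ * (Real.exp (-w p) * kap l u h₁₁ h₁₂ h (2 * l - 1) p)) p)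
    (hka : ∀ᶠ q in 𝓝 p, HasD (-I) (fun q => Real.exp (-w q) * a q)
      (μ * (Real.exp (-w q) * h 2 q)) q)
    (hac : ∀ q, a q + c q = h₁₁ q + h₁₂ q) (hac' : a p * c p = h₁₁ p * h₁₂ p)
    (hk : kap l u h₁₁ h₁₂ h 1 p = Real.exp (-w p) * a p + Real.exp (w p) * c p)
    (hw : weight l u h₁₁ h₁₂ h 1 p =
      a p * (Real.exp (-w p) * conj (a p)) + c p * (Real.exp (w p) * conj (c p)))
    (hX : ContDiffAt ℝ 2 (fun q => ‖a q‖ ^ 2 * Real.exp (-w q) - gam l μ u h₁₁ h₁₂ h 1 q) p)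
    (h0 : ‖a p‖ ^ 2 * Real.exp (-w p) - gam l μ u h₁₁ h₁₂ h 1 p ≠ 0) :
    Laplacian.laplacian
      (fun q => Real.log (‖a q‖ ^ 2 * Real.exp (-w q) - gam l μ u h₁₁ h₁₂ h 1 q)) p =
      Real.exp (u 2 p - w p) * (1 - g l μ u h₁₁ h₁₂ h 3 p /
        (‖a p‖ ^ 2 * Real.exp (-w p) - gam l μ u h₁₁ h₁₂ h 1 p) ^ 2) := by
  have hp0 := hp.self_of_nhds
  have hXe : ∀ q, ((‖a q‖ ^ 2 * Real.exp (-w q) - gam l μ u h₁₁ h₁₂ h 1 q : ℝ) : ℂ) =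
      a q * (Real.exp (-w q) * conj (a q)) - gam l μ u h₁₁ h₁₂ h 1 q := fun q => by
    push_cast
    rw [← Complex.mul_conj']
    ring
  have hF1 : ∀ᶠ q in 𝓝 p, HasD (-I)
      (fun q => ((‖a q‖ ^ 2 * Real.exp (-w q) - gam l μ u h₁₁ h₁₂ h 1 q : ℝ) : ℂ))
      (μ * (h 2 q * conj (Real.exp (-w q) * a q)) - (conj μ)⁻¹ *
        (c q * conj (kap l u h₁₁ h₁₂ h (2 * l - 1) q))) q := by
    filter_upwards [hp, ha, hka] with q hq haq hkq
    have e1 := hq.gam_zbar (j := 1) (c := 2 * l - 1) (by omega) hμ (by omega) le_rfl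
      ⟨1, by zify [show 1 ≤ 2 * l by omega]; ring⟩
    have e2 := ((haq.mul hkq.conj_dz).sub e1).conj_dzbar
    simp only [map_sub, map_mul, Complex.conj_conj, Complex.conj_ofReal] at e2
    simp only [hXe]
    refine (e2.congr_of_eventuallyEq (Filter.Eventually.of_forall fun q => by ring)).congr_deriv ?_
    -- The derivative of `γ_1` contains the sum `a + c`; its `a` part cancels against the derivative
    -- of `a`, and only the other entry `c` survives.
    rw [show 2 * l - 1 + 1 = 2 * l by omega, hext_two_mul, ← hac]
    simp only [map_add, map_mul, map_inv₀, Complex.conj_conj, Complex.conj_ofReal]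
    linear_combination (conj μ)⁻¹ * a q * conj (kap l u h₁₁ h₁₂ h (2 * l - 1) q) *
      exp_mul_exp_neg (w q)
  have d1 := hp0.h_zbar 2 le_rfl (by omega)
  have d2 := hka.self_of_nhds.conj_dz
  have d3 := (hp0.kap_z (2 * l - 1) (by omega) le_rfl).conj_dz
  have hF2 := ((d1.mul d2).const_mul μ).sub ((hc.mul d3).const_mul (conj μ)⁻¹)
  refine laplacian_log_eq_of_hasD hX h0 hF1 hF2 ?_
  have hμ' : conj μ ≠ 0 := by simpa using hμ
  have v1 : vexp l u 2 p = u 2 p := if_pos (by omega)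
  have v2 : vexp l u (2 * l - 1) p = -u 2 p := by
    rw [← v1, ← vexp_reflect (by omega)]
    congr 1
  have hr : ((Real.exp (u 2 p - w p) * (1 - g l μ u h₁₁ h₁₂ h 3 p /
        (‖a p‖ ^ 2 * Real.exp (-w p) - gam l μ u h₁₁ h₁₂ h 1 p) ^ 2) : ℝ) : ℂ) *
      ((‖a p‖ ^ 2 * Real.exp (-w p) - gam l μ u h₁₁ h₁₂ h 1 p : ℝ) : ℂ) ^ 2 =
      (Real.exp (u 2 p) : ℂ) * (Real.exp (w p) : ℂ)⁻¹ *
        (((‖a p‖ ^ 2 * Real.exp (-w p) - gam l μ u h₁₁ h₁₂ h 1 p : ℝ) : ℂ) ^ 2 -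
          g l μ u h₁₁ h₁₂ h 3 p) := by
    rw [Real.exp_sub]
    norm_cast
    field_simp
  rw [hr, g_three hl hμ, hw, hXe]
  rw [show 2 - 1 = 1 by rfl, hk, show 2 * l - 1 + 1 = 2 * l by omega, hext_two_mul, ← hac, ← hac',
    kap_of_one_lt (by omega), kap_of_one_lt (by omega), v1, v2]
  rw [← map_mul conj (h₁₁ p), ← hac']
  simp only [neg_neg, Real.exp_neg, map_sub, map_add, map_mul, map_inv₀, Complex.conj_conj,
    Complex.conj_ofReal, Complex.ofReal_inv]
  refine Eq.trans ?_ ((boundary_algebra (a := a p) (b := h 2 p) (c := c p) (f := h (2 * l - 1) p)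
    (a' := conj (a p)) (b' := conj (h 2 p)) (c' := conj (c p)) (f' := conj (h (2 * l - 1) p))
    (x := gam l μ u h₁₁ h₁₂ h 1 p) hμ hμ'
    (e := Real.exp (w p)) (t := Real.exp (u 2 p)) (by exact_mod_cast (Real.exp_pos _).ne')
    (by exact_mod_cast (Real.exp_pos _).ne')).trans ?_) <;> ring

variable {D : Set Plane}

/-! ### Components of the Lax pair -/

theorem block_modEq_iff {N s t : ℕ} (hs : 1 ≤ s) (hs' : s ≤ N) (ht : 1 ≤ t) (ht' : t ≤ N) :
    s ≡ t + 1 [MOD N] ↔ s = t + 1 ∨ t = N ∧ s = 1 := by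
  constructor
  · intro h1
    obtain ⟨k, hk⟩ := (Nat.modEq_iff_dvd.1 h1)
    push_cast at hk
    have h2 : k < 2 := by
      by_contra! h2
      nlinarith
    have h3 : -1 < k := by
      by_contra! h3
      nlinarith
    obtain rfl | rfl : k = 0 ∨ k = 1 := by omega
    · omega
    · omega
  · rintro (rfl | ⟨rfl, rfl⟩)
    · rfl
    · simp [Nat.ModEq]

theorem block_spec (l : ℕ) (a : Fin (2 * l)) : 1 ≤ block a ∧ block a ≤ 2 * l - 1 := by
  have := a.2
  unfold block
  omega

theorem J_mulVec (hl : 2 ≤ l) (y : ℕ → ℂ) (a : Fin (2 * l)) :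
    (J l).mulVec (fun b => y b) a =
      if block a = 2 * l - 1 then y 0 + y 1 else y (block a + 1) := by
  have ha := block_spec l a
  simp only [Matrix.mulVec, dotProduct, J, Matrix.of_apply, ite_mul, one_mul, zero_mul]
  have e : ∀ b : Fin (2 * l), (block b ≡ block a + 1 [MOD 2 * l - 1]) ↔
      (block b = block a + 1 ∨ block a = 2 * l - 1 ∧ block b = 1) := fun b =>
    block_modEq_iff (block_spec l b).1 (block_spec l b).2 ha.1 ha.2
  simp only [e]
  rw [Fin.sum_univ_eq_sum_range (fun b => if block b = block a + 1 ∨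
    block a = 2 * l - 1 ∧ block b = 1 then y b else 0)]
  split_ifs with h1
  · rw [Finset.sum_eq_add_of_mem (a := 0) (b := 1) (by simp; omega) (by simp; omega) (by norm_num)]
    · have h2 : max (a : ℕ) 1 = 2 * l - 1 := h1
      simp [block, h2]
    · intro c hc hc'
      rw [if_neg]
      rw [Finset.mem_range] at hc
      unfold block at *
      omega
  · rw [Finset.sum_eq_single_of_mem (block a + 1) (by simp; omega)]
    · rw [if_pos]
      left
      rw [block, max_eq_left (by omega)]
    · intro c hc hc'
      rw [if_neg]
      unfold block at *
      omega

theorem J_transpose_mulVec (hl : 2 ≤ l) (y : ℕ → ℂ) (a : Fin (2 * l)) :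
    (J l).transpose.mulVec (fun b => y b) a =
      if block a = 1 then y (2 * l - 1) else if block a = 2 then y 0 + y 1
      else y (block a - 1) := by
  have ha := block_spec l a
  simp only [Matrix.mulVec, dotProduct, J, Matrix.transpose_apply, Matrix.of_apply, ite_mul,
    one_mul, zero_mul]
  have e : ∀ b : Fin (2 * l), (block a ≡ block b + 1 [MOD 2 * l - 1]) ↔
      (block a = block b + 1 ∨ block b = 2 * l - 1 ∧ block a = 1) := fun b =>
    block_modEq_iff ha.1 ha.2 (block_spec l b).1 (block_spec l b).2
  simp only [e]
  rw [Fin.sum_univ_eq_sum_range (fun b => if block a = block b + 1 ∨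
    block b = 2 * l - 1 ∧ block a = 1 then y b else 0)]
  split_ifs with h1 h2
  · rw [Finset.sum_eq_single_of_mem (2 * l - 1) (by simp; omega)]
    · rw [if_pos]
      right
      rw [block, max_eq_left (by omega)]
      exact ⟨rfl, h1⟩
    · intro c hc hc'
      rw [if_neg]
      unfold block at *
      omega
  · rw [Finset.sum_eq_add_of_mem (a := 0) (b := 1) (by simp; omega) (by simp; omega) (by norm_num)]
    · simp [block] at h2 ⊢
      simp [h2]
    · intro c hc hc'
      rw [if_neg]
      unfold block at *
      omega
  · rw [Finset.sum_eq_single_of_mem (block a - 1) (by simp; omega)]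
    · rw [if_pos]
      left
      unfold block at *
      omega
    · intro c hc hc'
      rw [if_neg]
      unfold block at *
      omega

theorem V_inv : (V l u p)⁻¹ =
    Matrix.diagonal fun a => ((Real.exp (-exponent l u p a) : ℝ) : ℂ) := by
  refine Matrix.inv_eq_right_inv ?_
  rw [V, Matrix.diagonal_mul_diagonal, ← Matrix.diagonal_one]
  congr 1
  funext a
  rw [exp_mul_exp_neg]

theorem P_eq : P l u p = Matrix.diagonal fun a =>
    dz (fun q => ((Real.exp (exponent l u q a) : ℝ) : ℂ)) p *
      ((Real.exp (-exponent l u p a) : ℝ) : ℂ) := by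
  rw [P, V_inv]
  ext a b
  rw [Matrix.mul_diagonal]
  by_cases hab : a = b
  · subst hab
    simp [V]
  · rw [Matrix.diagonal_apply_ne _ hab, Matrix.of_apply]
    simp [V, Matrix.diagonal_apply_ne _ hab, dz, dx, dy]

/-- The entry `a` of the column `H`. -/
def entry (h₁₁ h₁₂ : Plane → ℂ) (h : ℕ → Plane → ℂ) (a : ℕ) (q : Plane) : ℂ :=
  if a = 0 then h₁₁ q else if a = 1 then h₁₂ q else h a q

theorem IsLaxSolution.dz_entry (hL : IsLaxSolution l D μ u (column l h₁₁ h₁₂ h)) (hp : p ∈ D)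
    (a : Fin (2 * l)) : dz (entry h₁₁ h₁₂ h a) p =
      μ * (J l).mulVec (fun b => entry h₁₁ h₁₂ h b p) a +
        dz (fun q => ((Real.exp (exponent l u q a) : ℝ) : ℂ)) p *
          ((Real.exp (-exponent l u p a) : ℝ) : ℂ) * entry h₁₁ h₁₂ h a p := by
  have h1 := congrFun (hL.2 p hp).1 a
  rw [Matrix.add_mulVec, Matrix.smul_mulVec, P_eq, Pi.add_apply, Matrix.mulVec_diagonal] at h1
  exact h1

theorem IsLaxSolution.dzbar_entry (hL : IsLaxSolution l D μ u (column l h₁₁ h₁₂ h)) (hp : p ∈ D)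
    (a : Fin (2 * l)) : dzbar (entry h₁₁ h₁₂ h a) p =
      μ⁻¹ * (((Real.exp (exponent l u p a) : ℝ) : ℂ) * (J l).transpose.mulVec
        (fun b => ((Real.exp (-exponent l u p b) : ℝ) : ℂ) * entry h₁₁ h₁₂ h b p) a) := by
  have h1 := congrFun (hL.2 p hp).2 a
  rw [Matrix.smul_mulVec, Q, V_inv, ← Matrix.mulVec_mulVec, ← Matrix.mulVec_mulVec, V,
    Pi.smul_apply, Matrix.mulVec_diagonal] at h1
  refine h1.trans ?_
  rw [smul_eq_mul]
  refine congrArg₂ _ rfl (congrArg₂ _ rfl (congrArg (fun y => (J l).transpose.mulVec y a) ?_))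
  funext b
  rw [Matrix.mulVec_diagonal]
  rfl

theorem differentiableAt_entry (hD : IsOpen D)
    (hL : IsLaxSolution l D μ u (column l h₁₁ h₁₂ h)) (hp : p ∈ D)
    (a : Fin (2 * l)) : DifferentiableAt ℝ (entry h₁₁ h₁₂ h a) p :=
  (hL.1 a).differentiableAt (hD.mem_nhds hp)

/-- The exponent of the entry `a` of `V`. -/
def nexponent (l : ℕ) (u : ℕ → Plane → ℝ) (p : Plane) (a : ℕ) : ℝ :=
  if a = 0 then u 1 p else if a = 1 then -u 1 p else vexp l u a p

theorem exponent_eq (a : Fin (2 * l)) : exponent l u p a = nexponent l u p a := rfl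

theorem contDiffOn_exponent {n : ℕ∞} (hl : 1 ≤ l)
    (hu : ∀ j ∈ Finset.Icc 1 l, ContDiffOn ℝ n (u j) D) {a : ℕ} (ha : a < 2 * l) :
    ContDiffOn ℝ n (fun q => nexponent l u q a) D := by
  have h1 := hu 1 (by simp; omega)
  unfold nexponent vexp
  split_ifs
  · exact h1
  · exact h1.neg
  · exact hu _ (by simp; omega)
  · exact (hu _ (by simp; omega)).neg

theorem reducedLax (hl : 3 ≤ l) (hD : IsOpen D) {n : ℕ∞} (hn : 1 ≤ n)
    (hu : ∀ j ∈ Finset.Icc 1 l, ContDiffOn ℝ n (u j) D)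
    (hL : IsLaxSolution l D μ u (column l h₁₁ h₁₂ h)) (hp : p ∈ D) :
    ReducedLax l μ u h₁₁ h₁₂ h p := by
  have hbar : ∀ a : Fin (2 * l), HasD I (entry h₁₁ h₁₂ h a) (μ⁻¹ * (Real.exp (nexponent l u p a) *
      if block a = 1 then ((Real.exp (-nexponent l u p (2 * l - 1)) : ℝ) : ℂ) *
          entry h₁₁ h₁₂ h (2 * l - 1) p
      else if block a = 2 then ((Real.exp (-nexponent l u p 0) : ℝ) : ℂ) * entry h₁₁ h₁₂ h 0 p +
        ((Real.exp (-nexponent l u p 1) : ℝ) : ℂ) * entry h₁₁ h₁₂ h 1 p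
      else ((Real.exp (-nexponent l u p (block a - 1)) : ℝ) : ℂ) *
        entry h₁₁ h₁₂ h (block a - 1) p)) p := by
    intro a
    refine ⟨differentiableAt_entry hD hL hp a, ?_⟩
    rw [← J_transpose_mulVec (by omega)
      (fun b => ((Real.exp (-nexponent l u p b) : ℝ) : ℂ) * entry h₁₁ h₁₂ h b p)]
    exact hL.dzbar_entry hp a
  have hz : ∀ a : Fin (2 * l), HasD (-I)
      (fun q => Real.exp (-nexponent l u q a) * entry h₁₁ h₁₂ h a q)
      (μ * (Real.exp (-nexponent l u p a) *
        if block a = 2 * l - 1 then entry h₁₁ h₁₂ h 0 p + entry h₁₁ h₁₂ h 1 p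
        else entry h₁₁ h₁₂ h (block a + 1) p)) p := by
    intro a
    have hv : DifferentiableAt ℝ (fun q => nexponent l u q a) p :=
      ((contDiffOn_exponent (by omega) hu a.2).contDiffAt (hD.mem_nhds hp)).differentiableAt
        (by exact_mod_cast (by positivity : n ≠ 0))
    have h0 : HasD (-I) (fun q => (nexponent l u q a : ℂ)) _ p :=
      ⟨(Complex.ofRealCLM.differentiableAt (x := nexponent l u p a)).comp p hv, rfl⟩
    have h1 := h0.ofReal_comp (Real.hasDerivAt_exp _)
    have h2 := h0.ofReal_comp (ψ := fun t => Real.exp (-t)) ((hasDerivAt_neg _).exp)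
    have h3 : HasD (-I) (entry h₁₁ h₁₂ h a) (dz (entry h₁₁ h₁₂ h a) p) p :=
      ⟨differentiableAt_entry hD hL hp a, by rw [dz]; ring⟩
    have h4 := hL.dz_entry hp a
    have h5 : dz (fun q => ((Real.exp (exponent l u q a) : ℝ) : ℂ)) p = _ :=
      Eq.trans (by rw [dz, sub_eq_add_neg, ← neg_mul]; rfl) h1.2
    rw [h5, J_mulVec (by omega) (fun b => entry h₁₁ h₁₂ h b p), exponent_eq] at h4
    rw [h4] at h3
    refine (h2.mul h3).congr_deriv ?_
    have h6 := exp_mul_exp_neg (nexponent l u p a)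
    push_cast at h6 ⊢
    -- Differentiating the factor `e^{-v}` cancels the diagonal term `V_z V⁻¹`.
    linear_combination (dx (fun q => (nexponent l u q a : ℂ)) p + -I *
      dy (fun q => (nexponent l u q a : ℂ)) p) * cexp (-(nexponent l u p a : ℂ)) *
        entry h₁₁ h₁₂ h a p * h6
  have hb : ∀ c, 2 ≤ c → block c = c := fun c hc => max_eq_left (by omega)
  have hent : ∀ c, 2 ≤ c → entry h₁₁ h₁₂ h c = h c := fun c hc => by
    funext q
    rw [entry, if_neg (by omega), if_neg (by omega)]
  have hexp : ∀ c, 2 ≤ c → ∀ q, nexponent l u q c = vexp l u c q := fun c hc q => by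
    rw [nexponent, if_neg (by omega), if_neg (by omega)]
  have hkap : ∀ c, 2 ≤ c → (fun q => (Real.exp (-nexponent l u q c) : ℂ) * entry h₁₁ h₁₂ h c q) =
      kap l u h₁₁ h₁₂ h c := fun c hc => by
    funext q
    rw [hexp c hc, hent c hc, kap_of_one_lt hc]
  constructor
  · refine (hbar ⟨0, by omega⟩).congr_deriv ?_
    rw [← hkap _ (by omega)]
    simp [block, nexponent]
  · refine (hbar ⟨1, by omega⟩).congr_deriv ?_
    rw [← hkap _ (by omega)]
    simp [block, nexponent]
  · intro c h1 h2
    have h3 := hbar ⟨c, by omega⟩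
    rw [hb c h1] at h3
    simp only [hent c h1, hexp c h1] at h3
    refine h3.congr_deriv ?_
    rw [if_neg (by omega)]
    split_ifs with h4
    · subst h4
      rw [show 2 - 1 = 1 by rfl, kap_one]
      simp [nexponent, entry]
    · rw [← hkap _ (by omega)]
  · refine (hz ⟨0, by omega⟩).congr_deriv ?_
    simp [block, nexponent, hent, show 1 ≠ 2 * l - 1 by omega]
  · have h3 := (hz ⟨1, by omega⟩)
    simp [block, nexponent, show 1 ≠ 2 * l - 1 by omega, entry] at h3 ⊢
    exact h3
  · intro c h1 h2
    have h3 := hz ⟨c, by omega⟩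
    rw [hb c h1, hkap c h1, hexp c h1] at h3
    refine h3.congr_deriv ?_
    split_ifs with h4
    · rw [h4, show 2 * l - 1 + 1 = 2 * l by omega, hext_two_mul]
      simp [entry]
    · rw [hent _ (by omega), hext_of_lt (by omega)]

variable {n : ℕ∞}

/-! ### Regularity -/

theorem contDiffOn_dz {k : ℕ} {f : Plane → ℂ} (hD : IsOpen D) (hf : ContDiffOn ℝ (k + 1) f D) :
    ContDiffOn ℝ k (dz f) D := by
  have h1 := ((contDiffOn_succ_iff_fderiv_of_isOpen hD).1 hf).2.2
  exact (h1.clm_apply contDiffOn_const).sub (contDiffOn_const.mul (h1.clm_apply contDiffOn_const))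

theorem contDiffOn_succ_of_dz_dzbar {k : ℕ} {f : Plane → ℂ} (hD : IsOpen D)
    (hf : ∀ q ∈ D, DifferentiableAt ℝ f q) (h1 : ContDiffOn ℝ k (dz f) D)
    (h2 : ContDiffOn ℝ k (dzbar f) D) : ContDiffOn ℝ (k + 1) f D := by
  refine (contDiffOn_succ_iff_fderiv_of_isOpen hD).2
    ⟨fun q hq => (hf q hq).differentiableWithinAt, by simp, ?_⟩
  refine contDiffOn_clm_apply.2 fun v => ?_
  have h3 : ∀ q, fderiv ℝ f q v =
      (v 0 : ℂ) * (2⁻¹ * (dz f q + dzbar f q)) +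
        (v 1 : ℂ) * ((2 * I)⁻¹ * (dzbar f q - dz f q)) := by
    intro q
    have h4 : v =
        v 0 • EuclideanSpace.single 0 (1 : ℝ) + v 1 • EuclideanSpace.single 1 (1 : ℝ) := by
      ext i
      fin_cases i <;> simp
    conv_lhs => rw [h4]
    rw [map_add, map_smul, map_smul, dz, dzbar, dx, dy]
    simp only [Complex.real_smul]
    field_simp
    ring
  simp only [h3]
  exact (contDiffOn_const.mul (contDiffOn_const.mul (h1.add h2))).add
    (contDiffOn_const.mul (contDiffOn_const.mul (h2.sub h1)))

theorem _root_.ContDiffOn.ofReal {k : WithTop ℕ∞} {f : Plane → ℝ} (hf : ContDiffOn ℝ k f D) :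
    ContDiffOn ℝ k (fun q => (f q : ℂ)) D :=
  Complex.ofRealCLM.contDiff.comp_contDiffOn hf

/-- Bootstrapping: the Lax pair expresses both first derivatives of `H` through `H` itself and at
most first derivatives of `u`, so `H` gains one order at a time until the order of `u` is reached.
The induction runs over finite orders, which also covers `n = ∞`. -/
theorem contDiffOn_entry (hl : 3 ≤ l) (hD : IsOpen D)
    (hu : ∀ j ∈ Finset.Icc 1 l, ContDiffOn ℝ n (u j) D)
    (hL : IsLaxSolution l D μ u (column l h₁₁ h₁₂ h)) (a : Fin (2 * l)) :
    ContDiffOn ℝ n (entry h₁₁ h₁₂ h a) D := by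
  have hE : ∀ a : Fin (2 * l), ContDiffOn ℝ n (fun q => exponent l u q a) D := fun a =>
    contDiffOn_exponent (by omega) hu a.2
  have key : ∀ k : ℕ, (k : ℕ∞) ≤ n → ∀ a : Fin (2 * l), ContDiffOn ℝ k (entry h₁₁ h₁₂ h a) D := by
    intro k
    induction k with
    | zero =>
      intro _ a
      exact contDiffOn_zero.2 fun q hq =>
        (differentiableAt_entry hD hL hq a).continuousAt.continuousWithinAt
    | succ k ih =>
      intro hk a
      have hk' : (k : ℕ∞) ≤ n := le_trans (by exact_mod_cast k.le_succ) hk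
      have hk1 : ((k : WithTop ℕ∞) + 1) ≤ n := by exact_mod_cast hk
      have hk2 : (k : WithTop ℕ∞) ≤ n := by exact_mod_cast hk'
      have hexp : ∀ a : Fin (2 * l),
          ContDiffOn ℝ k (fun q => ((Real.exp (-exponent l u q a) : ℝ) : ℂ)) D := fun a =>
        ((hE a).of_le hk2).neg.exp.ofReal
      push_cast
      refine contDiffOn_succ_of_dz_dzbar hD (fun q hq => differentiableAt_entry hD hL hq a) ?_ ?_
      · refine ContDiffOn.congr ?_ fun q hq => hL.dz_entry hq a
        refine (contDiffOn_const.mul ?_).add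
          (((contDiffOn_dz hD ((hE a).of_le hk1).exp.ofReal).mul (hexp a)).mul (ih hk' a))
        simp only [Matrix.mulVec, dotProduct]
        exact ContDiffOn.sum fun b _ => contDiffOn_const.mul (ih hk' b)
      · refine ContDiffOn.congr ?_ fun q hq => hL.dzbar_entry hq a
        refine contDiffOn_const.mul (((hE a).of_le hk2).exp.ofReal.mul ?_)
        simp only [Matrix.mulVec, dotProduct]
        exact ContDiffOn.sum fun b _ => contDiffOn_const.mul ((hexp b).mul (ih hk' b))
  exact contDiffOn_iff_forall_nat_le.2 fun k hk => key k (by exact_mod_cast hk) a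

/-- The components of the solution and the functions `u` are of class `C^n`. -/
structure Regular (l : ℕ) (n : ℕ∞) (D : Set Plane) (u : ℕ → Plane → ℝ) (h₁₁ h₁₂ : Plane → ℂ)
    (h : ℕ → Plane → ℂ) : Prop where
  u_contDiffOn : ∀ j, 1 ≤ j → j ≤ l → ContDiffOn ℝ n (u j) D
  h₁₁_contDiffOn : ContDiffOn ℝ n h₁₁ D
  h₁₂_contDiffOn : ContDiffOn ℝ n h₁₂ D
  h_contDiffOn : ∀ c, 2 ≤ c → c ≤ 2 * l - 1 → ContDiffOn ℝ n (h c) D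

theorem regular_of_isLaxSolution (hl : 3 ≤ l) (hD : IsOpen D)
    (hu : ∀ j ∈ Finset.Icc 1 l, ContDiffOn ℝ n (u j) D)
    (hL : IsLaxSolution l D μ u (column l h₁₁ h₁₂ h)) : Regular l n D u h₁₁ h₁₂ h where
  u_contDiffOn j h1 h2 := hu j (Finset.mem_Icc.2 ⟨h1, h2⟩)
  h₁₁_contDiffOn := contDiffOn_entry hl hD hu hL ⟨0, by omega⟩
  h₁₂_contDiffOn := contDiffOn_entry hl hD hu hL ⟨1, by omega⟩
  h_contDiffOn c h1 h2 := by
    refine (contDiffOn_entry hl hD hu hL ⟨c, by omega⟩).congr fun q _ => ?_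
    rw [entry, if_neg (by simp; omega), if_neg (by simp; omega)]

namespace Regular

theorem gam_contDiffOn (hl : 1 ≤ l) (hR : Regular l n D u h₁₁ h₁₂ h) (j : ℤ) :
    ContDiffOn ℝ n (gam l μ u h₁₁ h₁₂ h j) D := by
  have h1 := hR.u_contDiffOn 1 le_rfl hl
  refine contDiffOn_const.mul (((contDiffOn_const.mul
    (((hR.h₁₁_contDiffOn.norm_sq ℝ).mul h1.neg.exp).add
      ((hR.h₁₂_contDiffOn.norm_sq ℝ).mul h1.exp))).add ?_).add ?_)
  · refine ContDiffOn.sum fun c hc => ?_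
    rw [Finset.mem_Icc] at hc
    exact (contDiffOn_const.mul ((hR.h_contDiffOn c hc.1 (by omega)).norm_sq ℝ)).mul
      (hR.u_contDiffOn c (by omega) hc.2).neg.exp
  · refine ContDiffOn.sum fun c hc => ?_
    rw [Finset.mem_Icc] at hc
    exact (contDiffOn_const.mul ((hR.h_contDiffOn _ (by omega) (by omega)).norm_sq ℝ)).mul
      (hR.u_contDiffOn c (by omega) hc.2).exp

theorem g_contDiffOn (hl : 1 ≤ l) (hR : Regular l n D u h₁₁ h₁₂ h) (j : ℤ) :
    ContDiffOn ℝ n (g l μ u h₁₁ h₁₂ h j) D := by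
  refine (contDiffOn_const.mul (ContDiffOn.norm_sq ℝ (((contDiffOn_const.mul
    hR.h₁₁_contDiffOn).mul hR.h₁₂_contDiffOn).add (ContDiffOn.sum fun c hc => ?_)))).sub
    ((contDiffOn_const.mul (hR.gam_contDiffOn hl _)).mul (hR.gam_contDiffOn hl _))
  rw [Finset.mem_Icc] at hc
  exact (contDiffOn_const.mul (hR.h_contDiffOn _ (by omega) (by omega))).mul
    (hR.h_contDiffOn c hc.1 hc.2)

theorem num_contDiffOn (hl : 1 ≤ l) (hR : Regular l n D u h₁₁ h₁₂ h) : ContDiffOn ℝ n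
    (fun q => ‖h₁₁ q‖ ^ 2 * Real.exp (-u 1 q) - gam l μ u h₁₁ h₁₂ h 1 q) D :=
  ((hR.h₁₁_contDiffOn.norm_sq ℝ).mul (hR.u_contDiffOn 1 le_rfl hl).neg.exp).sub
    (hR.gam_contDiffOn hl 1)

theorem den_contDiffOn (hl : 1 ≤ l) (hR : Regular l n D u h₁₁ h₁₂ h) : ContDiffOn ℝ n
    (fun q => ‖h₁₂ q‖ ^ 2 * Real.exp (u 1 q) - gam l μ u h₁₁ h₁₂ h 1 q) D :=
  ((hR.h₁₂_contDiffOn.norm_sq ℝ).mul (hR.u_contDiffOn 1 le_rfl hl).exp).sub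
    (hR.gam_contDiffOn hl 1)

end Regular

/-! ### The transformed system -/

/-- Nonvanishing suffices, as `Real.log` is the logarithm of the absolute value; numerator and
denominator may both be negative. -/
theorem laplacian_add_log_div {w f k : Plane → ℝ} (hw : ContDiffAt ℝ 2 w p)
    (hf : ContDiffAt ℝ 2 f p) (hk : ContDiffAt ℝ 2 k p) (hf0 : f p ≠ 0) (hk0 : k p ≠ 0) :
    Laplacian.laplacian (fun q => w q + Real.log (f q / k q)) p = Laplacian.laplacian w p +
      (Laplacian.laplacian (fun q => Real.log (f q)) p -
        Laplacian.laplacian (fun q => Real.log (k q)) p) := by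
  have e : (fun q => w q + Real.log (f q / k q)) =ᶠ[𝓝 p]
      w + ((fun q => Real.log (f q)) - fun q => Real.log (k q)) := by
    filter_upwards [hf.continuousAt.eventually_ne hf0, hk.continuousAt.eventually_ne hk0]
      with q h1 h2
    simp [Real.log_div h1 h2]
  rw [(InnerProductSpace.laplacian_congr_nhds e).eq_of_nhds,
    hw.laplacian_add (f₂ := (fun q => Real.log (f q)) - fun q => Real.log (k q))
      ((hf.log hf0).sub (hk.log hk0)), (hf.log hf0).laplacian_sub (hk.log hk0)]

theorem laplacian_log_mul {f k : Plane → ℝ}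
    (hf : ContDiffAt ℝ 2 f p) (hk : ContDiffAt ℝ 2 k p) (hf0 : f p ≠ 0) (hk0 : k p ≠ 0) :
    Laplacian.laplacian (fun q => Real.log (f q * k q)) p =
      Laplacian.laplacian (fun q => Real.log (f q)) p +
        Laplacian.laplacian (fun q => Real.log (k q)) p := by
  have e : (fun q => Real.log (f q * k q)) =ᶠ[𝓝 p]
      (fun q => Real.log (f q)) + fun q => Real.log (k q) := by
    filter_upwards [hf.continuousAt.eventually_ne hf0, hk.continuousAt.eventually_ne hk0]
      with q h1 h2
    simp [Real.log_mul h1 h2]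
  rw [(InnerProductSpace.laplacian_congr_nhds e).eq_of_nhds,
    (hf.log hf0).laplacian_add (hk.log hk0)]

theorem factor_one : factor l μ u h₁₁ h₁₂ h 1 q =
    (‖h₁₁ q‖ ^ 2 * Real.exp (-u 1 q) - gam l μ u h₁₁ h₁₂ h 1 q) /
      (‖h₁₂ q‖ ^ 2 * Real.exp (u 1 q) - gam l μ u h₁₁ h₁₂ h 1 q) := if_pos rfl

theorem factor_of_one_lt {j : ℕ} (hj : 1 < j) : factor l μ u h₁₁ h₁₂ h j q =
    g l μ u h₁₁ h₁₂ h (j + 1) q / g l μ u h₁₁ h₁₂ h j q := if_neg hj.ne'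

/-- Since `x / 0 = 0`, positivity of a quotient already contains that it is defined. -/
theorem ne_zero_of_div_pos {x y : ℝ} (hxy : 0 < x / y) : x ≠ 0 ∧ y ≠ 0 := by
  constructor <;> rintro rfl <;> simp at hxy

theorem exp_darboux {j : ℕ} (hj : 0 < factor l μ u h₁₁ h₁₂ h j q) :
    Real.exp (darboux l μ u h₁₁ h₁₂ h j q) =
      Real.exp (u j q) * factor l μ u h₁₁ h₁₂ h j q := by
  rw [darboux, Real.exp_add, Real.exp_log hj]

theorem darboux_contDiffOn (hl : 1 ≤ l) (hR : Regular l n D u h₁₁ h₁₂ h) {j : ℕ} (h1 : 1 ≤ j)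
    (h2 : j ≤ l) (hpos : ∀ q ∈ D, 0 < factor l μ u h₁₁ h₁₂ h j q) :
    ContDiffOn ℝ n (darboux l μ u h₁₁ h₁₂ h j) D := by
  refine (hR.u_contDiffOn j h1 h2).add (ContDiffOn.log ?_ fun q hq => (hpos q hq).ne')
  rcases eq_or_lt_of_le h1 with rfl | h3
  · simp only [factor_one] at hpos ⊢
    exact (hR.num_contDiffOn hl).div (hR.den_contDiffOn hl)
      fun q hq => (ne_zero_of_div_pos (hpos q hq)).2
  · have e : factor l μ u h₁₁ h₁₂ h j = fun q => g l μ u h₁₁ h₁₂ h (j + 1) q /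
        g l μ u h₁₁ h₁₂ h j q := funext fun q => factor_of_one_lt h3
    rw [e] at hpos ⊢
    exact (hR.g_contDiffOn hl _).div (hR.g_contDiffOn hl _)
      fun q hq => (ne_zero_of_div_pos (hpos q hq)).2

theorem laplacian_log_num (hl : 3 ≤ l) (hμ : μ ≠ 0)
    (hp : ∀ᶠ q in 𝓝 p, ReducedLax l μ u h₁₁ h₁₂ h q)
    (hX : ContDiffAt ℝ 2
      (fun q => ‖h₁₁ q‖ ^ 2 * Real.exp (-u 1 q) - gam l μ u h₁₁ h₁₂ h 1 q) p)
    (h0 : ‖h₁₁ p‖ ^ 2 * Real.exp (-u 1 p) - gam l μ u h₁₁ h₁₂ h 1 p ≠ 0) :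
    Laplacian.laplacian
      (fun q => Real.log (‖h₁₁ q‖ ^ 2 * Real.exp (-u 1 q) - gam l μ u h₁₁ h₁₂ h 1 q)) p =
      Real.exp (u 2 p - u 1 p) * (1 - g l μ u h₁₁ h₁₂ h 3 p /
        (‖h₁₁ p‖ ^ 2 * Real.exp (-u 1 p) - gam l μ u h₁₁ h₁₂ h 1 p) ^ 2) := by
  refine laplacian_log_boundary (c := h₁₂) (w := u 1) hl hμ hp (hp.mono fun q hq => hq.h₁₁_zbar)
    hp.self_of_nhds.h₁₂_zbar (hp.mono fun q hq => hq.k₁₁_z) (fun _ => rfl) rfl kap_one ?_ hX h0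
  rw [weight, if_pos rfl]
  simp only [map_mul, Complex.conj_ofReal]

/-- Interchanging the two entries of the double block amounts to replacing `u₁` by `-u₁`. -/
theorem laplacian_log_den (hl : 3 ≤ l) (hμ : μ ≠ 0)
    (hp : ∀ᶠ q in 𝓝 p, ReducedLax l μ u h₁₁ h₁₂ h q)
    (hY : ContDiffAt ℝ 2
      (fun q => ‖h₁₂ q‖ ^ 2 * Real.exp (u 1 q) - gam l μ u h₁₁ h₁₂ h 1 q) p)
    (h0 : ‖h₁₂ p‖ ^ 2 * Real.exp (u 1 p) - gam l μ u h₁₁ h₁₂ h 1 p ≠ 0) :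
    Laplacian.laplacian
      (fun q => Real.log (‖h₁₂ q‖ ^ 2 * Real.exp (u 1 q) - gam l μ u h₁₁ h₁₂ h 1 q)) p =
      Real.exp (u 2 p + u 1 p) * (1 - g l μ u h₁₁ h₁₂ h 3 p /
        (‖h₁₂ p‖ ^ 2 * Real.exp (u 1 p) - gam l μ u h₁₁ h₁₂ h 1 p) ^ 2) := by
  have h1 := laplacian_log_boundary (a := h₁₂) (c := h₁₁) (w := fun q => -u 1 q) hl hμ hp
    (hp.mono fun q hq => hq.h₁₂_zbar)
    (by simpa only [neg_neg] using hp.self_of_nhds.h₁₁_zbar)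
    (by simpa only [neg_neg] using hp.mono fun q hq => hq.k₁₂_z)
    (fun _ => add_comm _ _) (mul_comm _ _)
    (by rw [kap_one, neg_neg, add_comm])
    (by
      rw [weight, if_pos rfl, neg_neg, add_comm]
      simp only [map_mul, Complex.conj_ofReal])
    (by simpa only [neg_neg] using hY) (by simpa only [neg_neg] using h0)
  simpa only [neg_neg, sub_neg_eq_add] using h1

end EllipticToda

/-! ### Assembly of the transformed Toda equations -/

open EllipticToda in
theorem mainTheorem8 (l : ℕ) (hl : 3 ≤ l) (n : ℕ∞) (hn : 2 ≤ n)
    (D : Set EllipticToda.Plane) (hD : IsOpen D)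
    (u : ℕ → EllipticToda.Plane → ℝ) (hu : EllipticToda.IsTodaSolution l n D u)
    (μ : ℂ) (hμ : μ ≠ 0) (hμ1 : ‖μ‖ ≠ 1)
    (h₁₁ h₁₂ : EllipticToda.Plane → ℂ) (h : ℕ → EllipticToda.Plane → ℂ)
    (hh : EllipticToda.IsLaxSolution l D μ u (EllipticToda.column l h₁₁ h₁₂ h))
    (hpos : ∀ p ∈ D, ∀ j ∈ Finset.Icc 1 l,
      0 < EllipticToda.factor l μ u h₁₁ h₁₂ h j p) :
    EllipticToda.IsTodaSolution l n D (EllipticToda.darboux l μ u h₁₁ h₁₂ h) := by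
  have hl1 : 1 ≤ l := by omega
  have hR : Regular l n D u h₁₁ h₁₂ h := regular_of_isLaxSolution hl hD hu.1 hh
  refine ⟨fun j hj => darboux_contDiffOn hl1 hR (Finset.mem_Icc.1 hj).1 (Finset.mem_Icc.1 hj).2
    fun q hq => hpos q hq j hj, fun p hp => ?_⟩
  have hnhds := hD.mem_nhds hp
  have hn2 : (2 : WithTop ℕ∞) ≤ n := WithTop.coe_le_coe.2 hn
  have smooth : ∀ {f : Plane → ℝ}, ContDiffOn ℝ n f D → ContDiffAt ℝ 2 f p := fun hf =>
    (hf.contDiffAt hnhds).of_le hn2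
  have hlax : ∀ᶠ q in nhds p, ReducedLax l μ u h₁₁ h₁₂ h q := by
    filter_upwards [hnhds] with q hq
    exact reducedLax hl hD (le_trans one_le_two hn) hu.1 hh hq
  have hfac : ∀ j, 1 ≤ j → j ≤ l → 0 < factor l μ u h₁₁ h₁₂ h j p := fun j h1 h2 =>
    hpos p hp j (Finset.mem_Icc.2 ⟨h1, h2⟩)
  have hexp : ∀ j, 1 ≤ j → j ≤ l → Real.exp (darboux l μ u h₁₁ h₁₂ h j p) =
      Real.exp (u j p) * factor l μ u h₁₁ h₁₂ h j p := fun j h1 h2 => exp_darboux (hfac j h1 h2)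
  have hXY := hfac 1 le_rfl hl1
  rw [factor_one] at hXY
  obtain ⟨hX0, hY0⟩ := ne_zero_of_div_pos hXY
  -- Each `g_j` with `j ≤ l` is the denominator of a factor; `g_{l+1}` occurs only as the numerator
  -- of the last one.
  have hg0 : ∀ j : ℕ, 2 ≤ j → j ≤ l + 1 → g l μ u h₁₁ h₁₂ h j p ≠ 0 := by
    intro j h1 h2
    rcases eq_or_lt_of_le h2 with rfl | h3
    · have h4 := hfac l hl1 le_rfl
      rw [factor_of_one_lt (by omega)] at h4
      exact_mod_cast (ne_zero_of_div_pos h4).1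
    · have h4 := hfac j (by omega) (by omega)
      rw [factor_of_one_lt (by omega)] at h4
      exact (ne_zero_of_div_pos h4).2
  have hlapX := laplacian_log_num hl hμ hlax (smooth (hR.num_contDiffOn hl1)) hX0
  have hlapY := laplacian_log_den hl hμ hlax (smooth (hR.den_contDiffOn hl1)) hY0
  have hlapg : ∀ j : ℕ, 3 ≤ j → j ≤ l + 1 →
      Laplacian.laplacian (fun q => Real.log (g l μ u h₁₁ h₁₂ h j q)) p = _ := fun j h1 h2 =>
    laplacian_log_g hl hμ hlax h1 h2 (smooth (hR.g_contDiffOn hl1 j)) (hg0 j (by omega) h2)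
  have hlap : ∀ j : ℕ, 2 ≤ j → j ≤ l → Laplacian.laplacian (darboux l μ u h₁₁ h₁₂ h j) p =
      Laplacian.laplacian (u j) p +
        (Laplacian.laplacian (fun q => Real.log (g l μ u h₁₁ h₁₂ h (j + 1 : ℕ) q)) p -
          Laplacian.laplacian (fun q => Real.log (g l μ u h₁₁ h₁₂ h j q)) p) := by
    intro j h1 h2
    have e : darboux l μ u h₁₁ h₁₂ h j = fun q => u j q +
        Real.log (g l μ u h₁₁ h₁₂ h (j + 1 : ℕ) q / g l μ u h₁₁ h₁₂ h j q) := funext fun q => by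
      rw [darboux, factor_of_one_lt (by omega)]
      norm_cast
    rw [e, laplacian_add_log_div (smooth (hR.u_contDiffOn j (by omega) h2))
      (smooth (hR.g_contDiffOn hl1 _)) (smooth (hR.g_contDiffOn hl1 _))
      (hg0 (j + 1) (by omega) (by omega)) (hg0 j h1 (by omega))]
  have hg2 := g_two (μ := μ) (u := u) (h₁₁ := h₁₁) (h₁₂ := h₁₂) (h := h) (q := p)
    (show 2 ≤ l by omega)
  -- The bilinear identity starts at `j = 3`; for `g_2` the factorization into numerator and
  -- denominator of the first factor takes its place.
  have hlap2 : Laplacian.laplacian (fun q => Real.log (g l μ u h₁₁ h₁₂ h (2 : ℕ) q)) p =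
      Real.exp (u 2 p - u 1 p) * (1 - g l μ u h₁₁ h₁₂ h 3 p /
        (‖h₁₁ p‖ ^ 2 * Real.exp (-u 1 p) - gam l μ u h₁₁ h₁₂ h 1 p) ^ 2) +
      Real.exp (u 2 p + u 1 p) * (1 - g l μ u h₁₁ h₁₂ h 3 p /
        (‖h₁₂ p‖ ^ 2 * Real.exp (u 1 p) - gam l μ u h₁₁ h₁₂ h 1 p) ^ 2) := by
    have e := laplacian_log_mul (smooth (hR.num_contDiffOn (μ := μ) hl1))
      (smooth (hR.den_contDiffOn (μ := μ) hl1)) hX0 hY0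
    rw [hlapX, hlapY] at e
    simpa only [Nat.cast_ofNat, g_two (show 2 ≤ l by omega)] using e
  have hv : ∀ j, j ≤ l → vexp l u j p = u j p := fun j hj => if_pos hj
  -- The step from block `l` to block `l + 1` has exponent `-2 u_l`, the last exponent of the Toda
  -- system.
  have hvl : vexp l u (l + 1) p = -u l p := by
    rw [vexp, if_neg (by omega), show 2 * l + 1 - (l + 1) = l by omega]
  obtain ⟨E1, E2, E3, E4⟩ := hu.2 p hp
  have hg3 : g l μ u h₁₁ h₁₂ h 3 p ≠ 0 := by exact_mod_cast hg0 3 (by omega) (by omega)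
  refine ⟨?_, ?_, ?_, ?_⟩
  · have e : darboux l μ u h₁₁ h₁₂ h 1 = fun q => u 1 q + Real.log (_ / _) :=
      funext fun q => by rw [darboux, factor_one]
    conv_lhs => rw [e]
    rw [laplacian_add_log_div (smooth (hR.u_contDiffOn 1 le_rfl hl1))
      (smooth (hR.num_contDiffOn hl1)) (smooth (hR.den_contDiffOn hl1)) hX0 hY0, hlapX, hlapY, E1,
      Real.exp_add (darboux _ _ _ _ _ _ _ _), Real.exp_sub (darboux _ _ _ _ _ _ _ _),
      hexp 1 le_rfl hl1, hexp 2 (by omega) (by omega), factor_one, factor_of_one_lt (by omega),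
      Real.exp_add, Real.exp_sub]
    generalize ‖h₁₁ p‖ ^ 2 * Real.exp (-u 1 p) - gam l μ u h₁₁ h₁₂ h 1 p = X at hX0 hg2 ⊢
    generalize ‖h₁₂ p‖ ^ 2 * Real.exp (u 1 p) - gam l μ u h₁₁ h₁₂ h 1 p = Y at hY0 hg2 ⊢
    norm_num
    -- Substituting `g_2 = X Y` turns `(g_3 / g_2) (X / Y)` into `g_3 / Y²` and `(g_3 / g_2) / (X /
    -- Y)` into `g_3 / X²`, the terms of the two boundary Laplacians.
    rw [hg2]
    field_simp
    ring
  · rw [hlap 2 le_rfl (by omega), hlapg (2 + 1) (by omega) (by omega), hlap2, E2,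
      Real.exp_add (darboux _ _ _ _ _ _ _ _), Real.exp_sub (darboux _ _ _ _ _ _ _ _),
      Real.exp_sub (darboux _ _ _ _ _ _ _ _),
      hexp 1 le_rfl hl1, hexp 2 (by omega) (by omega), hexp 3 (by omega) hl, factor_one,
      factor_of_one_lt (by omega), factor_of_one_lt (by omega), hv _ (by omega), hv _ (by omega),
      Real.exp_add, Real.exp_sub, Real.exp_sub]
    generalize ‖h₁₁ p‖ ^ 2 * Real.exp (-u 1 p) - gam l μ u h₁₁ h₁₂ h 1 p = X at hX0 hg2 ⊢
    generalize ‖h₁₂ p‖ ^ 2 * Real.exp (u 1 p) - gam l μ u h₁₁ h₁₂ h 1 p = Y at hY0 hg2 ⊢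
    norm_num
    rw [hg2]
    field_simp
    ring
  · intro j hj
    rw [Finset.mem_Icc] at hj
    have n1 := hg0 (j - 1) (by omega) (by omega)
    have n2 := hg0 j (by omega) (by omega)
    have n3 := hg0 (j + 1) (by omega) (by omega)
    rw [hlap j (by omega) (by omega), hlapg (j + 1) (by omega) (by omega),
      hlapg j (by omega) (by omega), E3 j (Finset.mem_Icc.2 hj),
      Real.exp_sub (darboux _ _ _ _ _ _ _ _), Real.exp_sub (darboux _ _ _ _ _ _ _ _),
      hexp (j - 1) (by omega) (by omega), hexp j (by omega) (by omega),
      hexp (j + 1) (by omega) (by omega), factor_of_one_lt (by omega),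
      factor_of_one_lt (by omega), factor_of_one_lt (by omega), Nat.add_sub_cancel,
      hv (j - 1) (by omega), hv j (by omega), hv (j + 1) (by omega)]
    simp only [Real.exp_sub]
    push_cast [show 1 ≤ j by omega] at n1 n2 n3 ⊢
    rw [show (j : ℤ) + 1 - 1 = j by ring, show (j : ℤ) - 1 + 1 = j by ring]
    field_simp
    ring
  · have n1 := hg0 (l - 1) (by omega) (by omega)
    have n2 := hg0 l (by omega) (by omega)
    have n3 := hg0 (l + 1) (by omega) (by omega)
    rw [hlap l (by omega) le_rfl, hlapg (l + 1) (by omega) le_rfl,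
      hlapg l (by omega) (by omega), E4, hvl, Nat.add_sub_cancel, hv l le_rfl,
      hv (l - 1) (by omega),
      show -u l p - u l p = -(u l p + u l p) by ring, show -2 * u l p = -(u l p + u l p) by ring,
      show -2 * darboux l μ u h₁₁ h₁₂ h l p =
        -(darboux l μ u h₁₁ h₁₂ h l p + darboux l μ u h₁₁ h₁₂ h l p) by ring,
      Real.exp_sub (darboux _ _ _ _ _ _ _ _), Real.exp_neg, Real.exp_neg,
      Real.exp_add (darboux _ _ _ _ _ _ _ _),
      hexp (l - 1) (by omega) (by omega), hexp l (by omega) le_rfl, factor_of_one_lt (by omega),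
      factor_of_one_lt (by omega), Real.exp_sub, Real.exp_add]
    push_cast [hl1] at n1 n2 n3 ⊢
    -- Here `g_{l+2} = g_l` makes `g_{l+2} g_l / g_{l+1}²` the inverse square of the factor of
    -- `e^{u_l}`, as `e^{-2ũ_l}` requires.
    rw [show (l : ℤ) + 1 - 1 = l by ring, show (l : ℤ) - 1 + 1 = l by ring,
      show (l : ℤ) + 1 + 1 = l + 2 by ring, g_reflect (by omega)]
    field_simp
    ring
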